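/- **Setting.** Let $L>0$, let $A_0,A_1,A_2:[0,L]\to\mathbb R^{n\times n}$, $B_1:[0,L]\to\mathbb R^{n\times m}$, $C_a,C_b:[0,L]\to\mathbb R^{q\times n}$ be essentially bounded and measurable, and let $C_1\in\mathbb R^{q\times 4n}$, $D_1\in\mathbb R^{q\times m}$, $B\in\mathbb R^{2n\times 4n}$ be such that $$B_2:=B\begin{bmatrix}I&0\\ I&LI\\ 0&I\\ 0&I\end{bmatrix}$$ is invertible (so $B$ has rank $2n$). Let $X$ be the set of $x\in W^{2,n}([0,L])$ (that is, $x,x_s,x_{ss}\in L_2^n([0,L])$) with $B\,[x(0);x(L);x_s(0);x_s(L)]=0$. Consider $$\dot x(s,t)=A_0(s)x(s,t)+A_1(s)x_s(s,t)+A_2(s)x_{ss}(s,t)+B_1(s)w(t),\qquad x(s,0)=0,\qquad Bz(t)=0,$$ $$y(t)=C_1z(t)+\int_0^L\big(C_a(s)x(s,t)+C_b(s)x_s(s,t)\big)ds+D_1w(t),\qquad z(t)=\begin{bmatrix}x(0,t)\\ x(L,t)\\ x_s(0,t)\\ x_s(L,t)\end{bmatrix}.\tag{1}$$ A solution is a locally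 absolutely continuous $x:[0,\infty)\to L_2^n([0,L])$ with locally integrable derivative, $x(0)=0$, and $x(t)\in X$ and (1) for almost every $t\ge 0$; the output $y:[0,\infty)\to\mathbb R^q$ is measurable. **Operators.** For $M(s),N_1(s,\theta),N_2(s,\theta)\in\mathbb R^{n\times n}$ set $$(\mathcal P_{\{M,N_1,N_2\}}x)(s)=M(s)x(s)+\int_0^sN_1(s,\theta)x(\theta)d\theta+\int_s^LN_2(s,\theta)x(\theta)d\theta ;$$ it is coercive if for some $\epsilon>0$, $\langle x,\mathcal P_{\{M,N_1,N_2\}}x\rangle_{L_2}\ge\epsilon\|x\|_{L_2}^2$ for all $x\in L_2^n([0,L])$. For $x_1\in\mathbb R^m$, $x_2\in L_2^n([0,L])$ set $$\Big(\mathcal P_{\{P,Q,R_1,R_2\}}\begin{bmatrix}x_1\\x_2\end{bmatrix}\Big)(s)=\begin{bmatrix}Px_1+\frac1L\int_0^LQ(s)x_2(s)ds\\ Q(s)^Tx_1+\int_0^sR_1(s,\theta)x_2(\theta)d\theta+\int_s^LR_2(s,\theta)x_2(\theta)d\theta\end{bmatrix};$$ $\mathcal P_{\{P,Q,R_1,R_2\}}\le0$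 means $\int_0^L[x_1;x_2(s)]^T\big(\mathcal P_{\{P,Q,R_1,R_2\}}[x_1;x_2]\big)(s)\,ds\le0$ for all such $x_1,x_2$. **The data $P,Q,R_1,R_2$.** Let $\mathcal I(r)=1$ for $r\ge0$, $\mathcal I(r)=0$ for $r<0$, and $$B_c(\eta)=-B_2^{-1}B\begin{bmatrix}0\\(L-\eta)I\\0\\I\end{bmatrix},\quad B_a(s,\eta)=[I\;\;sI]B_c(\eta),\quad B_b(\eta)=[0\;\;I]B_c(\eta),$$ $$G(s,\eta)=B_a(s,\eta)+\mathcal I(s-\eta)(s-\eta)I,\qquad G_s(s,\eta)=B_b(\eta)+\mathcal I(s-\eta)I,$$ $$C_3(\theta)=C_1\left(\begin{bmatrix}I&0\\I&LI\\0&I\\0&I\end{bmatrix}B_c(\theta)+\begin{bmatrix}0\\(L-\theta)I\\0\\I\end{bmatrix}\right)+\int_0^L\big(C_a(s)G(s,\theta)+C_b(s)G_s(s,\theta)\big)ds .$$ Given $\gamma\ge0$ and $M,N_1,N_2$, define $$P=\tfrac1L(D_1^TD_1-\gamma^2I),\qquad Q(s)=D_1^TC_3(s)+\int_0^LV(s,\theta)^Td\theta,$$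 $$V(s,\eta)=\Big(G(\eta,s)^TM(\eta)+\int_\eta^LG(\beta,s)^TN_1(\beta,\eta)d\beta+\int_0^\eta G(\beta,s)^TN_2(\beta,\eta)d\beta\Big)B_1(\eta),$$ $$R_1(s,\theta)=H_1(s,\theta)+H_2(\theta,s)^T+C_3(s)^TC_3(\theta),\qquad R_2(s,\theta)=R_1(\theta,s)^T,$$ $$(H_1,H_2)=\mathcal L_1(V_2,W_{21},W_{22})+\mathcal L_2(V_1,W_{11},W_{12})+\mathcal L_3(V_0,W_{01},W_{02}),\quad V_i(s)=M(s)A_i(s),\; W_{ij}(s,\theta)=N_j(s,\theta)A_i(\theta).$$ Here $\mathcal L_1,\mathcal L_2,\mathcal L_3$ are the following linear maps of a triple $(M,N_1,N_2)$: $$\mathcal L_1=(E_1+Y_1,\,E_2+Y_1),\qquad \mathcal L_2=(F_1+F_3,\,F_2+F_3),\qquad \mathcal L_3=(G_1+G_3,\,G_2+G_3),$$ $$Y_1(s,\eta)=B_a(\eta,s)^TM(\eta)+\int_\eta^LB_a(\theta,s)^TN_1(\theta,\eta)d\theta+\int_0^\eta B_a(\theta,s)^TN_2(\theta,\eta)d\theta,$$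 $$Y_2(\zeta)=M(\zeta)+\int_0^\zeta N_1(\zeta,\theta)d\theta+\int_\zeta^LN_2(\zeta,\theta)d\theta,$$ $$Y_3(\zeta,\eta)=M(\zeta)B_a(\zeta,\eta)+\int_0^\zeta N_1(\zeta,\theta)B_a(\theta,\eta)d\theta+\int_\zeta^LN_2(\zeta,\theta)B_a(\theta,\eta)d\theta,$$ $$E_1(s,\theta)=\int_s^L(\eta-s)N_1(\eta,\theta)d\eta,\quad E_2(s,\theta)=(\theta-s)M(\theta)+\int_\theta^L(\eta-s)N_1(\eta,\theta)d\eta+\int_s^\theta(\eta-s)N_2(\eta,\theta)d\eta,$$ $$F_4(\theta,\eta)=M(\eta)+\int_\theta^\eta N_1(\eta,\zeta)d\zeta,\qquad F_5(s,\eta)=\int_s^\eta(\zeta-s)N_2(\zeta,\eta)d\zeta,$$ $$F_1(s,\theta)=\int_s^L\big((\eta-s)F_4(\theta,\eta)+F_5(s,\eta)\big)d\eta,\qquad F_2(s,\theta)=\int_\theta^L\big((\eta-s)F_4(\theta,\eta)+F_5(s,\eta)\big)d\eta,$$ $$F_3(s,\eta)=\int_0^LB_a(\zeta,s)^TY_2(\zeta)B_b(\eta)d\zeta+\int_\eta^LY_1(s,\zeta)d\zeta+\Big(\int_s^L(\zeta-s)Y_2(\zeta)d\zeta\Big)B_b(\eta),$$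 $$G_4(\theta,\eta)=(\eta-\theta)M(\eta)+\int_\theta^\eta(\zeta-\theta)N_1(\eta,\zeta)d\zeta,\qquad G_5(s,\theta,\eta)=\int_s^\eta(\zeta-s)(\eta-\theta)N_2(\zeta,\eta)d\zeta,$$ $$G_1(s,\theta)=\int_s^L\big((\eta-s)G_4(\theta,\eta)+G_5(s,\theta,\eta)\big)d\eta,\qquad G_2(s,\theta)=\int_\theta^L\big((\eta-s)G_4(\theta,\eta)+G_5(s,\theta,\eta)\big)d\eta,$$ $$G_3(s,\theta)=\int_0^LB_a(\eta,s)^TY_3(\eta,\theta)d\eta+\int_\theta^L(\eta-\theta)Y_1(s,\eta)d\eta+\int_s^L(\eta-s)Y_3(\eta,\theta)d\eta .$$ **Theorem.** Let $\gamma\ge0$. Suppose there exist matrix-valued polynomials $M:\mathbb R\to\mathbb R^{n\times n}$ and $N_1,N_2:\mathbb R\times\mathbb R\to\mathbb R^{n\times n}$ such that $\mathcal P_{\{M,N_1,N_2\}}$ is self-adjoint and coercive on $L_2^n([0,L])$ and $\mathcal P_{\{P,Q,R_1,R_2\}}\le0$ for the $P,Q,R_1,R_2$ defined above. Then for every $w\in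 L_2^m([0,\infty))$ and every solution $x$ of (1) with output $y$, one has $y\in L_2^q([0,\infty))$ and $\|y\|_{L_2}\le\gamma\|w\|_{L_2}$. -/

import Mathlib

open MeasureTheory Set
open scoped Matrix ENNReal

noncomputable section

namespace PDEGain

/-- Euclidean space of dimension `k`. -/
abbrev E (k : ℕ) := EuclideanSpace ℝ (Fin k)

/-- A real `a × b` matrix. -/
abbrev Mat (a b : ℕ) := Matrix (Fin a) (Fin b) ℝ

/-- The action of a matrix on a Euclidean vector. -/
def act {a b : ℕ} (A : Mat a b) (v : E b) : E a := WithLp.toLp 2 (A *ᵥ v.ofLp)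

/-- The entrywise integral `∫ t in a..b, F t` of a matrix-valued function. -/
def mint {ι κ : Type*} (a b : ℝ) (F : ℝ → Matrix ι κ ℝ) : Matrix ι κ ℝ :=
  Matrix.of fun i j => ∫ t in a..b, F t i j

/-- The block matrix whose `(i, j)` block is `c i j • I`, with `I` of size `n`. -/
def blk {ι κ : Type*} (n : ℕ) (c : Matrix ι κ ℝ) : Matrix (ι × Fin n) (κ × Fin n) ℝ :=
  Matrix.of fun p q => c p.1 q.1 * (1 : Mat n n) p.2 q.2

/-- The block column with blocks `c i • I`. -/
def colBlk {ι : Type*} (n : ℕ) (c : ι → ℝ) : Matrix (ι × Fin n) (Fin n) ℝ :=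
  Matrix.of fun p j => c p.1 * (1 : Mat n n) p.2 j

/-- The block row with blocks `c i • I`. -/
def rowBlk {ι : Type*} (n : ℕ) (c : ι → ℝ) : Matrix (Fin n) (ι × Fin n) ℝ :=
  Matrix.of fun i q => c q.1 * (1 : Mat n n) i q.2

/-- The indicator `𝓘(θ)`, equal to `1` for `θ ≥ 0` and to `0` for `θ < 0`. -/
def ind (θ : ℝ) : ℝ := if 0 ≤ θ then 1 else 0

/-- The data of the coupled linear PDE on `[0, L]` with `n` states, `m` inputs and `q` outputs. -/
structure System (n m q : ℕ) where
  L : ℝ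
  A0 : ℝ → Mat n n
  A1 : ℝ → Mat n n
  A2 : ℝ → Mat n n
  B1 : ℝ → Mat n m
  C1 : Matrix (Fin q) (Fin 4 × Fin n) ℝ
  Ca : ℝ → Mat q n
  Cb : ℝ → Mat q n
  D1 : Mat q m
  B : Matrix (Fin 2 × Fin n) (Fin 4 × Fin n) ℝ

/-- The matrix-valued functions `M, N₁, N₂` which parameterize an integral operator. -/
structure Kernel (n : ℕ) where
  M : ℝ → Mat n n
  N1 : ℝ → ℝ → Mat n n
  N2 : ℝ → ℝ → Mat n n

/-- The functions `M`, `N₁`, `N₂` given by matrices of polynomials in one and in two variables. -/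
def Kernel.ofPolynomials {n : ℕ} (M : Matrix (Fin n) (Fin n) (Polynomial ℝ))
    (N1 N2 : Matrix (Fin n) (Fin n) (MvPolynomial (Fin 2) ℝ)) : Kernel n where
  M := fun s => M.map fun p => p.eval s
  N1 := fun s θ => N1.map fun p => MvPolynomial.eval ![s, θ] p
  N2 := fun s θ => N2.map fun p => MvPolynomial.eval ![s, θ] p

/-- `(M(s) A(s), N₁(s,θ) A(θ), N₂(s,θ) A(θ))`. -/
def Kernel.mulRight {n : ℕ} (K : Kernel n) (A : ℝ → Mat n n) : Kernel n where
  M := fun s => K.M s * A s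
  N1 := fun s θ => K.N1 s θ * A θ
  N2 := fun s θ => K.N2 s θ * A θ

/-- Entrywise essentially bounded measurable matrix functions on `[0, L]`. -/
def EssBounded {a b : ℕ} (L : ℝ) (A : ℝ → Mat a b) : Prop :=
  ∀ i j, MemLp (fun s => A s i j) ⊤ (volume.restrict (Icc 0 L))

namespace System

variable {n m q : ℕ} (S : System n m q)

/-- Lebesgue measure on `[0, L]`. -/
abbrev μ : Measure ℝ := volume.restrict (Icc 0 S.L)

/-- `Z = L₂ⁿ([0, L])`. -/
abbrev Z := Lp (E n) 2 S.μ

/-! ### The state space and the solutions -/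

/-- The vector of boundary values `[u(0); u(L); u_s(0); u_s(L)]`. -/
def bdry (u us : ℝ → E n) : Fin 4 × Fin n → ℝ :=
  fun p => (![u 0, u S.L, us 0, us S.L] p.1) p.2

/-- `u` is in the domain `X`, with `us = u_s` and `uss = u_ss`: on `[0, L]` the function `u` is
the primitive of `us`, the function `us` is the absolutely continuous primitive of
`uss ∈ L₂([0, L])`, and the boundary values satisfy `B z = 0`. -/
structure IsState (u us uss : ℝ → E n) : Prop where
  memLp : MemLp uss 2 S.μ
  u_eq : ∀ s ∈ Icc 0 S.L, u s = u 0 + ∫ r in (0 : ℝ)..s, us r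
  us_eq : ∀ s ∈ Icc 0 S.L, us s = us 0 + ∫ r in (0 : ℝ)..s, uss r
  bc : S.B *ᵥ S.bdry u us = 0

/-- `A₀(s) u(s) + A₁(s) u_s(s) + A₂(s) u_ss(s) + B₁(s) w`. -/
def rhs (u us uss : ℝ → E n) (w : E m) (s : ℝ) : E n :=
  act (S.A0 s) (u s) + act (S.A1 s) (us s) + act (S.A2 s) (uss s) + act (S.B1 s) w

/-- `C₁ z + ∫₀ᴸ (C_a(s) u(s) + C_b(s) u_s(s)) ds + D₁ w`. -/
def output (u us : ℝ → E n) (w : E m) : E q :=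
  WithLp.toLp 2 (S.C1 *ᵥ S.bdry u us)
    + (∫ s in (0 : ℝ)..S.L, (act (S.Ca s) (u s) + act (S.Cb s) (us s))) + act S.D1 w

/-- `x : [0,∞) → Z` is a strong solution with input `w` and output `y`: it is locally absolutely
continuous into `Z` (the primitive of the locally Bochner integrable `xdot`) with `x(0) = 0`, and
for almost every `t ≥ 0` the state `x(t)` is in `X`, and the differential equation and
the output equation hold. -/
def IsSolution (w : ℝ → E m) (x : ℝ → S.Z) (y : ℝ → E q) : Prop :=
  ∃ xdot : ℝ → S.Z,
    (∀ T, 0 ≤ T → IntervalIntegrable xdot volume 0 T) ∧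
    (∀ t, 0 ≤ t → x t = ∫ τ in (0 : ℝ)..t, xdot τ) ∧
    ∀ᵐ t ∂(volume.restrict (Ici (0 : ℝ))), ∃ u us uss : ℝ → E n,
      S.IsState u us uss ∧ x t =ᵐ[S.μ] u ∧ xdot t =ᵐ[S.μ] S.rhs u us uss (w t) ∧
      y t = S.output u us (w t)

/-! ### The operators -/

/-- `(𝒫_{M,N₁,N₂} x)(s) = M(s) x(s) + ∫₀ˢ N₁(s,θ) x(θ) dθ + ∫ₛᴸ N₂(s,θ) x(θ) dθ`. -/
def opP (K : Kernel n) (x : ℝ → E n) (s : ℝ) : E n :=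
  act (K.M s) (x s) + (∫ θ in (0 : ℝ)..s, act (K.N1 s θ) (x θ))
    + ∫ θ in s..S.L, act (K.N2 s θ) (x θ)

/-- `𝒫_{M,N₁,N₂}` is coercive on `L₂ⁿ([0, L])`. -/
def Coercive (K : Kernel n) : Prop :=
  ∃ ε : ℝ, 0 < ε ∧ ∀ x : ℝ → E n, MemLp x 2 S.μ →
    ε * (∫ s in (0 : ℝ)..S.L, ‖x s‖ ^ 2) ≤ ∫ s in (0 : ℝ)..S.L, inner ℝ (x s) (S.opP K x s)

/-- `𝒫_{M,N₁,N₂}` is self-adjoint on `L₂ⁿ([0, L])`. -/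
def SelfAdjoint (K : Kernel n) : Prop :=
  ∀ x y : ℝ → E n, MemLp x 2 S.μ → MemLp y 2 S.μ →
    (∫ s in (0 : ℝ)..S.L, inner ℝ (x s) (S.opP K y s))
      = ∫ s in (0 : ℝ)..S.L, inner ℝ (S.opP K x s) (y s)

/-- The operator `𝒫_{P,Q,R₁,R₂}`, mapping `(x₁, x₂) ∈ ℝᵐ × L₂ⁿ([0, L])` to the pair
`(P x₁ + (1/L) ∫₀ᴸ Q(s) x₂(s) ds,
  Q(s)ᵀ x₁ + ∫₀ˢ R₁(s,θ) x₂(θ) dθ + ∫ₛᴸ R₂(s,θ) x₂(θ) dθ)`. -/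
def opPQRS (P : Mat m m) (Q : ℝ → Mat m n) (R1 R2 : ℝ → ℝ → Mat n n)
    (x1 : E m) (x2 : ℝ → E n) : E m × (ℝ → E n) :=
  (act P x1 + (1 / S.L) • ∫ s in (0 : ℝ)..S.L, act (Q s) (x2 s),
   fun s => act (Q s)ᵀ x1 + (∫ θ in (0 : ℝ)..s, act (R1 s θ) (x2 θ))
    + ∫ θ in s..S.L, act (R2 s θ) (x2 θ))

/-- `𝒫_{P,Q,R₁,R₂} ≤ 0` on `ℝᵐ × L₂ⁿ([0, L])`, in the `L₂([0, L])` inner product in which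
a vector of `ℝᵐ` is a constant function. -/
def PQRSNonpos (P : Mat m m) (Q : ℝ → Mat m n) (R1 R2 : ℝ → ℝ → Mat n n) : Prop :=
  ∀ (x1 : E m) (x2 : ℝ → E n), MemLp x2 2 S.μ →
    (∫ s in (0 : ℝ)..S.L,
      (inner ℝ x1 (S.opPQRS P Q R1 R2 x1 x2).1
        + inner ℝ (x2 s) ((S.opPQRS P Q R1 R2 x1 x2).2 s))) ≤ 0

/-! ### Representation of `x`, `x_s` and the output by `x_ss` -/

/-- `B₂ = B [I 0; I L; 0 I; 0 I]`. -/
def B2 : Matrix (Fin 2 × Fin n) (Fin 2 × Fin n) ℝ :=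
  S.B * blk n !![1, 0; 1, S.L; 0, 1; 0, 1]

/-- `B_c(η) = - B₂⁻¹ B [0; L - η; 0; I]`. -/
def Bc (η : ℝ) : Matrix (Fin 2 × Fin n) (Fin n) ℝ :=
  -(S.B2⁻¹ * (S.B * colBlk n ![0, S.L - η, 0, 1]))

/-- `B_a(s,η) = [I  sI] B_c(η)`. -/
def Ba (s η : ℝ) : Mat n n := rowBlk n ![1, s] * S.Bc η

/-- `B_b(η) = [0  I] B_c(η)`. -/
def Bb (η : ℝ) : Mat n n := rowBlk n ![0, 1] * S.Bc η

/-- The Green's function of `x`: `G(s,η) = [I  sI] B_c(η) + 𝓘(s-η)(s-η)`. -/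
def G (s η : ℝ) : Mat n n := S.Ba s η + (ind (s - η) * (s - η)) • (1 : Mat n n)

/-- The Green's function of `x_s`: `[0  I] B_c(η) + 𝓘(s-η)`. -/
def Gs (s η : ℝ) : Mat n n := S.Bb η + ind (s - η) • (1 : Mat n n)

/-- The kernel `C₃` with `𝒞 x = ∫₀ᴸ C₃(s) x_ss(s) ds`. -/
def C3 (θ : ℝ) : Mat q n :=
  S.C1 * (blk n !![1, 0; 1, S.L; 0, 1; 0, 1] * S.Bc θ + colBlk n ![0, S.L - θ, 0, 1])
    + mint 0 S.L fun s => S.Ca s * S.G s θ + S.Cb s * S.Gs s θ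

/-! ### The matrix `P` and the function `Q` -/

/-- `P = (D₁ᵀ D₁ - γ² I) / L`. -/
def P (γ : ℝ) : Mat m m := (1 / S.L) • (S.D1ᵀ * S.D1) - (γ ^ 2 / S.L) • (1 : Mat m m)

/-- `V(s,η) = (G(η,s)ᵀ M(η) + ∫_η^L G(β,s)ᵀ N₁(β,η) dβ + ∫_0^η G(β,s)ᵀ N₂(β,η) dβ) B₁(η)`. -/
def V (K : Kernel n) (s η : ℝ) : Mat n m :=
  ((S.G η s)ᵀ * K.M η + (mint η S.L fun β => (S.G β s)ᵀ * K.N1 β η)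
    + (mint 0 η fun β => (S.G β s)ᵀ * K.N2 β η)) * S.B1 η

/-- `Q(s) = D₁ᵀ C₃(s) + ∫₀ᴸ V(s,θ)ᵀ dθ`. -/
def Q (K : Kernel n) (s : ℝ) : Mat m n :=
  S.D1ᵀ * S.C3 s + mint 0 S.L fun θ => (S.V K s θ)ᵀ

/-! ### The linear maps `𝓛₁`, `𝓛₂`, `𝓛₃` and the functions `R₁`, `R₂` -/

def Y1 (K : Kernel n) (s η : ℝ) : Mat n n :=
  (S.Ba η s)ᵀ * K.M η + (mint η S.L fun θ => (S.Ba θ s)ᵀ * K.N1 θ η)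
    + mint 0 η fun θ => (S.Ba θ s)ᵀ * K.N2 θ η

def Y2 (K : Kernel n) (ζ : ℝ) : Mat n n :=
  K.M ζ + (mint 0 ζ fun θ => K.N1 ζ θ) + mint ζ S.L fun θ => K.N2 ζ θ

def Y3 (K : Kernel n) (ζ η : ℝ) : Mat n n :=
  K.M ζ * S.Ba ζ η + (mint 0 ζ fun θ => K.N1 ζ θ * S.Ba θ η)
    + mint ζ S.L fun θ => K.N2 ζ θ * S.Ba θ η

def E1 (K : Kernel n) (s θ : ℝ) : Mat n n := mint s S.L fun η => (η - s) • K.N1 η θ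

def E2 (K : Kernel n) (s θ : ℝ) : Mat n n :=
  (θ - s) • K.M θ + (mint θ S.L fun η => (η - s) • K.N1 η θ)
    + mint s θ fun η => (η - s) • K.N2 η θ

/-- `𝓛₁(M,N₁,N₂) = (E₁ + E₃, E₂ + E₃)` with `E₃ = Y₁`. -/
def L1 (K : Kernel n) : (ℝ → ℝ → Mat n n) × (ℝ → ℝ → Mat n n) :=
  (fun s θ => S.E1 K s θ + S.Y1 K s θ, fun s θ => S.E2 K s θ + S.Y1 K s θ)

def F4 (K : Kernel n) (θ η : ℝ) : Mat n n := K.M η + mint θ η fun ζ => K.N1 η ζ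

def F5 (K : Kernel n) (s η : ℝ) : Mat n n := mint s η fun ζ => (ζ - s) • K.N2 ζ η

def F1 (K : Kernel n) (s θ : ℝ) : Mat n n :=
  mint s S.L fun η => (η - s) • F4 K θ η + F5 K s η

def F2 (K : Kernel n) (s θ : ℝ) : Mat n n :=
  mint θ S.L fun η => (η - s) • F4 K θ η + F5 K s η

def F3 (K : Kernel n) (s η : ℝ) : Mat n n :=
  (mint 0 S.L fun ζ => (S.Ba ζ s)ᵀ * S.Y2 K ζ * S.Bb η)
    + (mint η S.L fun ζ => S.Y1 K s ζ)
    + (mint s S.L fun ζ => (ζ - s) • S.Y2 K ζ) * S.Bb η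

/-- `𝓛₂(M,N₁,N₂) = (F₁ + F₃, F₂ + F₃)`. -/
def L2 (K : Kernel n) : (ℝ → ℝ → Mat n n) × (ℝ → ℝ → Mat n n) :=
  (fun s θ => S.F1 K s θ + S.F3 K s θ, fun s θ => S.F2 K s θ + S.F3 K s θ)

def G4 (K : Kernel n) (θ η : ℝ) : Mat n n :=
  (η - θ) • K.M η + mint θ η fun ζ => (ζ - θ) • K.N1 η ζ

def G5 (K : Kernel n) (s θ η : ℝ) : Mat n n :=
  mint s η fun ζ => ((ζ - s) * (η - θ)) • K.N2 ζ η

def G1 (K : Kernel n) (s θ : ℝ) : Mat n n :=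
  mint s S.L fun η => (η - s) • G4 K θ η + G5 K s θ η

def G2 (K : Kernel n) (s θ : ℝ) : Mat n n :=
  mint θ S.L fun η => (η - s) • G4 K θ η + G5 K s θ η

def G3 (K : Kernel n) (s θ : ℝ) : Mat n n :=
  (mint 0 S.L fun η => (S.Ba η s)ᵀ * S.Y3 K η θ)
    + (mint θ S.L fun η => (η - θ) • S.Y1 K s η)
    + mint s S.L fun η => (η - s) • S.Y3 K η θ

/-- `𝓛₃(M,N₁,N₂) = (G₁ + G₃, G₂ + G₃)`. -/
def L3 (K : Kernel n) : (ℝ → ℝ → Mat n n) × (ℝ → ℝ → Mat n n) :=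
  (fun s θ => S.G1 K s θ + S.G3 K s θ, fun s θ => S.G2 K s θ + S.G3 K s θ)

/-- `(H₁, H₂)`: the map `𝓛₁` treats the term of `x_ss`, `𝓛₂` that of `x_s`, `𝓛₃` that of `x`. -/
def H (K : Kernel n) : (ℝ → ℝ → Mat n n) × (ℝ → ℝ → Mat n n) :=
  S.L1 (K.mulRight S.A2) + S.L2 (K.mulRight S.A1) + S.L3 (K.mulRight S.A0)

/-- `R₁(s,θ) = H₁(s,θ) + H₂(θ,s)ᵀ + C₃(s)ᵀ C₃(θ)`. -/
def R1 (K : Kernel n) (s θ : ℝ) : Mat n n :=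
  (S.H K).1 s θ + ((S.H K).2 θ s)ᵀ + (S.C3 s)ᵀ * S.C3 θ

/-- `R₂(s,θ) = R₁(θ,s)ᵀ`. -/
def R2 (K : Kernel n) (s θ : ℝ) : Mat n n := (S.R1 K θ s)ᵀ

end System

end PDEGain

end

/-! Write 𝒫 for `𝒫_{M,N₁,N₂}` and take the storage function v(t) = ⟨x(t), 𝒫 x(t)⟩. It vanishes at t
= 0, is nonnegative by coercivity, and self-adjointness gives v' = 2⟨x, 𝒫 ẋ⟩. Once v' + ‖y‖² ≤
γ²‖w‖² holds for almost every t, integrating over (0, T], dropping v(T) ≥ 0 and letting T → ∞ gives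
the gain bound.

The pointwise inequality is the hypothesis on `𝒫_{P,Q,R₁,R₂}` evaluated at the pair (w(t), x_ss(t)).
Taylor's formula expresses a state by x(0), x_s(0) and x_ss, and the boundary conditions with `B2`
invertible express x(0), x_s(0) by x_ss. Hence x, x_s and y are integrals of x_ss against `G`, `Gs`
and `C3` (`IsState.u_green`, `IsState.us_green`, `IsState.output_rep`). Consequently ⟨x, 𝒫 f⟩ = ∬
x_ss(s)ᵀ T(s,θ) f(θ) with T = Gᵀ composed with 𝒫 (`IsState.mI_u_Y`), and inserting the right-hand
side of the equation for f produces a kernel `R` acting on x_ss and a function `VB` acting on w.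

The computational core is that the explicit formulas for 𝓛₁, 𝓛₂, 𝓛₃ compute this `R`. Each Green's
function is a continuous part plus a truncated power (`green`), so each composition splits into
terms carrying boundary data and one purely truncated term (`mI_T_mul_green`, `mI_ind_T₀`). `H₁`
agrees with `R` for θ < s and `H₂` for s < θ, which is all that enters the operator, the diagonal
being null. Symmetrizing and completing the square of the output gives the identity
`IsState.energy`.

In time, the chain rule for v is proved in integrated form by Fubini on a square cut along its
diagonal (`inner_integral_eq_two_mul`), so no pointwise differentiation of Bochner integrals is
involved. -/

noncomputable section

namespace PDEGain

/-! ### Entrywise integrals, integrability and essential boundedness of matrix functions -/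

section MatrixIntegral

variable {α β ι κ ρ : Type*} [MeasurableSpace α] [MeasurableSpace β] {ν : Measure α}
  {ν' : Measure β}

/-- The entrywise integral of a matrix-valued function. -/
def mI (ν : Measure α) (F : α → Matrix ι κ ℝ) : Matrix ι κ ℝ :=
  Matrix.of fun i j => ∫ t, F t i j ∂ν

/-- Entrywise integrability. -/
def MInt (ν : Measure α) (F : α → Matrix ι κ ℝ) : Prop :=
  ∀ i j, Integrable (fun t => F t i j) ν

/-- Entrywise essential boundedness. -/
def MBdd (ν : Measure α) (F : α → Matrix ι κ ℝ) : Prop :=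
  ∀ i j, MemLp (fun t => F t i j) ⊤ ν

theorem MBdd.mInt [IsFiniteMeasure ν] {F : α → Matrix ι κ ℝ} (hF : MBdd ν F) : MInt ν F :=
  fun i j => (hF i j).integrable le_top

theorem MBdd.add {F G : α → Matrix ι κ ℝ} (hF : MBdd ν F) (hG : MBdd ν G) :
    MBdd ν fun t => F t + G t := fun i j => (hF i j).add (hG i j)

theorem MInt.add {F G : α → Matrix ι κ ℝ} (hF : MInt ν F) (hG : MInt ν G) :
    MInt ν fun t => F t + G t := fun i j => (hF i j).add (hG i j)

theorem MBdd.transpose {F : α → Matrix ι κ ℝ} (hF : MBdd ν F) : MBdd ν fun t => (F t)ᵀ :=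
  fun i j => hF j i

theorem MInt.transpose {F : α → Matrix ι κ ℝ} (hF : MInt ν F) : MInt ν fun t => (F t)ᵀ :=
  fun i j => hF j i

theorem MBdd.const [IsFiniteMeasure ν] (A : Matrix ι κ ℝ) : MBdd ν fun _ => A :=
  fun _ _ => memLp_top_const _

theorem MBdd.smul {f : α → ℝ} {F : α → Matrix ι κ ℝ} (hf : MemLp f ⊤ ν) (hF : MBdd ν F) :
    MBdd ν fun t => f t • F t := fun i j => (hF i j).mul hf

theorem MInt.smul {f : α → ℝ} {F : α → Matrix ι κ ℝ} (hf : MemLp f ⊤ ν) (hF : MInt ν F) :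
    MInt ν fun t => f t • F t := fun i j => (hF i j).mul_of_top_right hf

theorem MBdd.mul [Fintype κ] {F : α → Matrix ι κ ℝ} {G : α → Matrix κ ρ ℝ}
    (hF : MBdd ν F) (hG : MBdd ν G) : MBdd ν fun t => F t * G t := fun i j => by
  simp only [Matrix.mul_apply]
  exact memLp_finsetSum _ fun k _ => (hG k j).mul (hF i k)

theorem MBdd.mul_mInt [Fintype κ] {F : α → Matrix ι κ ℝ} {G : α → Matrix κ ρ ℝ}
    (hF : MBdd ν F) (hG : MInt ν G) : MInt ν fun t => F t * G t := fun i j => by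
  simp only [Matrix.mul_apply]
  exact integrable_finsetSum _ fun k _ => (hG k j).mul_of_top_right (hF i k)

theorem MInt.mul_mBdd [Fintype κ] {F : α → Matrix ι κ ℝ} {G : α → Matrix κ ρ ℝ}
    (hF : MInt ν F) (hG : MBdd ν G) : MInt ν fun t => F t * G t := fun i j => by
  simp only [Matrix.mul_apply]
  exact integrable_finsetSum _ fun k _ => (hF i k).mul_of_top_left (hG k j)

theorem MInt.const_mul [Fintype κ] (A : Matrix ι κ ℝ) {G : α → Matrix κ ρ ℝ}
    (hG : MInt ν G) : MInt ν fun t => A * G t := fun i j => by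
  simp only [Matrix.mul_apply]
  exact integrable_finsetSum _ fun k _ => (hG k j).const_mul _

theorem MInt.mul_const [Fintype κ] {G : α → Matrix ι κ ℝ}
    (hG : MInt ν G) (A : Matrix κ ρ ℝ) : MInt ν fun t => G t * A := fun i j => by
  simp only [Matrix.mul_apply]
  exact integrable_finsetSum _ fun k _ => (hG i k).mul_const _

theorem MBdd.fst [IsFiniteMeasure ν'] [SFinite ν] {F : α → Matrix ι κ ℝ} (hF : MBdd ν F) :
    MBdd (ν.prod ν') fun p => F p.1 := fun i j => (hF i j).comp_fst ν'

theorem MBdd.snd [IsFiniteMeasure ν] [SFinite ν'] {F : β → Matrix ι κ ℝ} (hF : MBdd ν' F) :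
    MBdd (ν.prod ν') fun p => F p.2 := fun i j => (hF i j).comp_snd ν

theorem MInt.fst [IsFiniteMeasure ν'] [SFinite ν] {F : α → Matrix ι κ ℝ} (hF : MInt ν F) :
    MInt (ν.prod ν') fun p => F p.1 := fun i j => (hF i j).comp_fst ν'

theorem MInt.snd [IsFiniteMeasure ν] [SFinite ν'] {F : β → Matrix ι κ ℝ} (hF : MInt ν' F) :
    MInt (ν.prod ν') fun p => F p.2 := fun i j => (hF i j).comp_snd ν

/-- A bounded kernel between two integrable factors is integrable on the product. -/
theorem MInt.mul_mBdd_mul_prod {ι' : Type*} [SFinite ν] [SFinite ν'] [Fintype κ] [Fintype ρ]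
    {F : α → Matrix ι κ ℝ}
    {T : α × β → Matrix κ ρ ℝ} {G : β → Matrix ρ ι' ℝ} (hF : MInt ν F)
    (hT : MBdd (ν.prod ν') T) (hG : MInt ν' G) :
    MInt (ν.prod ν') fun p => F p.1 * T p * G p.2 := fun i j => by
  simp only [Matrix.mul_apply, Finset.sum_mul]
  refine integrable_finsetSum _ fun k _ => integrable_finsetSum _ fun l _ => ?_
  have h := ((hF i l).mul_prod (hG k j)).mul_of_top_left (hT l k)
  refine h.congr (Filter.Eventually.of_forall fun p => ?_)
  simp only [Pi.mul_apply]
  ring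

theorem mI_congr {F G : α → Matrix ι κ ℝ} (h : ∀ᵐ t ∂ν, F t = G t) : mI ν F = mI ν G := by
  ext i j
  exact integral_congr_ae (h.mono fun t ht => by simp only [ht])

theorem MInt.congr {F G : α → Matrix ι κ ℝ} (hF : MInt ν F) (h : ∀ᵐ t ∂ν, F t = G t) :
    MInt ν G := fun i j => (hF i j).congr (h.mono fun t ht => by simp only [ht])

theorem MBdd.congr {F G : α → Matrix ι κ ℝ} (hF : MBdd ν F) (h : ∀ᵐ t ∂ν, F t = G t) :
    MBdd ν G := fun i j => (hF i j).ae_eq (h.mono fun t ht => by simp only [ht])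

theorem mI_add {F G : α → Matrix ι κ ℝ} (hF : MInt ν F) (hG : MInt ν G) :
    (mI ν fun t => F t + G t) = mI ν F + mI ν G := by
  ext i j
  exact integral_add (hF i j) (hG i j)

theorem mI_transpose (F : α → Matrix ι κ ℝ) : (mI ν fun t => (F t)ᵀ) = (mI ν F)ᵀ := rfl

theorem mI_smul (c : ℝ) (F : α → Matrix ι κ ℝ) : (mI ν fun t => c • F t) = c • mI ν F := by
  ext i j
  exact integral_const_mul c _

theorem mI_zero : (mI ν fun _ => (0 : Matrix ι κ ℝ)) = 0 := by
  ext i j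
  simp [mI]

theorem mI_const_mul [Fintype κ] (A : Matrix ι κ ℝ) {G : α → Matrix κ ρ ℝ} (hG : MInt ν G) :
    (mI ν fun t => A * G t) = A * mI ν G := by
  ext i j
  simp only [mI, Matrix.of_apply, Matrix.mul_apply]
  rw [integral_finsetSum _ fun k _ => (hG k j).const_mul _]
  exact Finset.sum_congr rfl fun k _ => integral_const_mul _ _

theorem mI_mul_const [Fintype κ] {G : α → Matrix ι κ ℝ} (hG : MInt ν G) (A : Matrix κ ρ ℝ) :
    (mI ν fun t => G t * A) = mI ν G * A := by
  ext i j
  simp only [mI, Matrix.of_apply, Matrix.mul_apply]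
  rw [integral_finsetSum _ fun k _ => (hG i k).mul_const _]
  exact Finset.sum_congr rfl fun k _ => integral_mul_const _ _

theorem mI_swap [SFinite ν] [SFinite ν'] {F : α → β → Matrix ι κ ℝ}
    (hF : MInt (ν.prod ν') fun p => F p.1 p.2) :
    (mI ν fun a => mI ν' fun b => F a b) = mI ν' fun b => mI ν fun a => F a b := by
  ext i j
  exact integral_integral_swap (hF i j)

theorem MInt.integral [SFinite ν] [SFinite ν'] {F : α → β → Matrix ι κ ℝ}
    (hF : MInt (ν.prod ν') fun p => F p.1 p.2) : MInt ν fun a => mI ν' fun b => F a b :=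
  fun i j => (hF i j).integral_prod_left

theorem MBdd.swap [SFinite ν] [SFinite ν'] {F : α → β → Matrix ι κ ℝ}
    (hF : MBdd (ν.prod ν') fun p => F p.1 p.2) :
    MBdd (ν'.prod ν) fun p => F p.2 p.1 := fun i j =>
  (hF i j).comp_measurePreserving Measure.measurePreserving_swap

/-- By Fubini the essential bound on the product holds on almost every section, and finiteness of
`ν'` turns it into a bound for the integral. -/
theorem MBdd.integral [SFinite ν] [IsFiniteMeasure ν'] {F : α → β → Matrix ι κ ℝ}
    (hF : MBdd (ν.prod ν') fun p => F p.1 p.2) : MBdd ν fun a => mI ν' fun b => F a b := by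
  intro i j
  have h := hF i j
  set C := (eLpNorm (fun p : α × β => F p.1 p.2 i j) ⊤ (ν.prod ν')).toReal
  have hC : ∀ᵐ p ∂(ν.prod ν'), ‖F p.1 p.2 i j‖ ≤ C := by
    filter_upwards [enorm_ae_le_eLpNormEssSup (fun p : α × β => F p.1 p.2 i j) (ν.prod ν')]
      with p hp
    have h2 := h.eLpNorm_ne_top
    rw [← eLpNorm_exponent_top] at hp
    rw [← toReal_enorm]
    exact ENNReal.toReal_mono h2 hp
  refine memLp_top_of_bound h.1.integral_prod_right' (C * ν'.real univ) ?_
  filter_upwards [Measure.ae_ae_of_ae_prod hC] with a ha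
  exact norm_integral_le_of_norm_le_const ha

end MatrixIntegral

/-! ### Measurable matrix functions with bounds at every point -/

section Tame

variable {Ω Ω' ι κ ρ : Type*} [MeasurableSpace Ω] [MeasurableSpace Ω']

/-- Entrywise measurable functions which are bounded on `D`. -/
def Tame (D : Set Ω) (F : Ω → Matrix ι κ ℝ) : Prop :=
  ∀ i j, Measurable (fun t => F t i j) ∧ ∃ C, ∀ t ∈ D, |F t i j| ≤ C

theorem Tame.mBdd {D : Set Ω} {F : Ω → Matrix ι κ ℝ} (hF : Tame D F) {ν : Measure Ω}
    (hν : ∀ᵐ t ∂ν, t ∈ D) : MBdd ν F := fun i j => by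
  obtain ⟨hm, C, hC⟩ := hF i j
  exact memLp_top_of_bound hm.aestronglyMeasurable C (hν.mono fun t ht => hC t ht)

/-- A bound at every point of `D` survives any measurable substitution into `D`, in particular
restriction to each individual section; an essential bound need not. For this reason the Green's
functions and the continuous kernels are kept in this class, and only the coefficients of the
equation are treated modulo null sets. -/
theorem Tame.comp {D : Set Ω} {F : Ω → Matrix ι κ ℝ} (hF : Tame D F) {D' : Set Ω'} {g : Ω' → Ω}
    (hg : Measurable g) (hD : ∀ t ∈ D', g t ∈ D) : Tame D' fun t => F (g t) := fun i j => by
  obtain ⟨hm, C, hC⟩ := hF i j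
  exact ⟨hm.comp hg, C, fun t ht => hC _ (hD t ht)⟩

theorem Tame.transpose {D : Set Ω} {F : Ω → Matrix ι κ ℝ} (hF : Tame D F) :
    Tame D fun t => (F t)ᵀ := fun i j => hF j i

theorem Tame.add {D : Set Ω} {F G : Ω → Matrix ι κ ℝ} (hF : Tame D F) (hG : Tame D G) :
    Tame D fun t => F t + G t := fun i j => by
  obtain ⟨hm, C, hC⟩ := hF i j
  obtain ⟨hm', C', hC'⟩ := hG i j
  exact ⟨hm.add hm', C + C', fun t ht =>
    (abs_add_le _ _).trans (add_le_add (hC t ht) (hC' t ht))⟩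

theorem Tame.mul [Fintype κ] {D : Set Ω} {F : Ω → Matrix ι κ ℝ} {G : Ω → Matrix κ ρ ℝ}
    (hF : Tame D F) (hG : Tame D G) : Tame D fun t => F t * G t := fun i j => by
  choose hm C hC using hF
  choose hm' C' hC' using hG
  simp only [Matrix.mul_apply]
  refine ⟨Finset.measurable_sum _ fun k _ => (hm i k).mul (hm' k j),
    ∑ k, C i k * C' k j, fun t ht => (Finset.abs_sum_le_sum_abs _ _).trans
      (Finset.sum_le_sum fun k _ => ?_)⟩
  rw [abs_mul]
  exact mul_le_mul (hC i k t ht) (hC' k j t ht) (abs_nonneg _)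
    ((abs_nonneg _).trans (hC i k t ht))

theorem Tame.const (D : Set Ω) (A : Matrix ι κ ℝ) : Tame D fun _ => A :=
  fun i j => ⟨measurable_const, |A i j|, fun _ _ => le_rfl⟩

theorem Tame.smul {D : Set Ω} {f : Ω → ℝ} (hf : Measurable f) {c : ℝ} (hc : ∀ t ∈ D, |f t| ≤ c)
    {F : Ω → Matrix ι κ ℝ} (hF : Tame D F) : Tame D fun t => f t • F t := fun i j => by
  obtain ⟨hm, C, hC⟩ := hF i j
  refine ⟨hf.mul hm, c * C, fun t ht => ?_⟩
  simp only [Matrix.smul_apply, smul_eq_mul, abs_mul]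
  exact mul_le_mul (hc t ht) (hC t ht) (abs_nonneg _) ((abs_nonneg _).trans (hc t ht))

theorem Tame.ite {D : Set Ω} {p : Ω → Prop} [DecidablePred p] (hp : MeasurableSet {t | p t})
    {F G : Ω → Matrix ι κ ℝ} (hF : Tame D F) (hG : Tame D G) :
    Tame D fun t => if p t then F t else G t := fun i j => by
  obtain ⟨hm, C, hC⟩ := hF i j
  obtain ⟨hm', C', hC'⟩ := hG i j
  have h : (fun t => (if p t then F t else G t) i j) =
      fun t => if p t then F t i j else G t i j := by
    funext t; split_ifs <;> rfl
  refine ⟨h ▸ Measurable.ite hp hm hm', max C C', fun t ht => ?_⟩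
  change |(if p t then F t else G t) i j| ≤ _
  split_ifs
  · exact le_max_of_le_left (hC t ht)
  · exact le_max_of_le_right (hC' t ht)

theorem Tame.integral {D : Set Ω} {D' : Set Ω'} {F : Ω → Ω' → Matrix ι κ ℝ} {ν : Measure Ω'}
    [IsFiniteMeasure ν] (hν : ∀ᵐ t ∂ν, t ∈ D') (hF : Tame (D ×ˢ D') fun p => F p.1 p.2) :
    Tame D fun s => mI ν fun t => F s t := fun i j => by
  obtain ⟨hm, C, hC⟩ := hF i j
  refine ⟨(hm.stronglyMeasurable.integral_prod_right' (ν := ν)).measurable, C * ν.real univ,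
    fun s hs => ?_⟩
  have h : ∀ᵐ t ∂ν, ‖F s t i j‖ ≤ C := hν.mono fun t ht => hC (s, t) ⟨hs, ht⟩
  exact norm_integral_le_of_norm_le_const h

theorem Tame.of_continuous [TopologicalSpace Ω] [OpensMeasurableSpace Ω] {D : Set Ω}
    (hD : IsCompact D) {F : Ω → Matrix ι κ ℝ} (hF : ∀ i j, Continuous fun t => F t i j) :
    Tame D F := fun i j =>
  ⟨(hF i j).measurable, hD.exists_bound_of_continuousOn (hF i j).continuousOn⟩

end Tame

end PDEGain

namespace PDEGain

/-! ### Bounded scalar weights -/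

section Scalars

variable {Ω : Type*} [MeasurableSpace Ω] {ν : Measure Ω}

theorem memLp_ite {p : Ω → Prop} [DecidablePred p] (hp : MeasurableSet {t | p t}) :
    MemLp (fun t => if p t then (1 : ℝ) else 0) ⊤ ν :=
  memLp_top_of_bound (Measurable.ite hp measurable_const measurable_const).aestronglyMeasurable 1
    (Filter.Eventually.of_forall fun t => by split_ifs <;> simp)

theorem memLp_ind {f : Ω → ℝ} (hf : Measurable f) : MemLp (fun t => ind (f t)) ⊤ ν :=
  memLp_ite (measurableSet_le measurable_const hf)

theorem memLp_continuous [TopologicalSpace Ω] [OpensMeasurableSpace Ω] {D : Set Ω}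
    (hD : IsCompact D) (hν : ∀ᵐ t ∂ν, t ∈ D) {f : Ω → ℝ} (hf : Continuous f) :
    MemLp f ⊤ ν := by
  obtain ⟨C, hC⟩ := hD.exists_bound_of_continuousOn hf.continuousOn
  exact memLp_top_of_bound hf.measurable.aestronglyMeasurable C (hν.mono fun t ht => hC t ht)

theorem MBdd.ite {ι κ : Type*} {p : Ω → Prop} [DecidablePred p] (hp : MeasurableSet {t | p t})
    {F G : Ω → Matrix ι κ ℝ} (hF : MBdd ν F) (hG : MBdd ν G) :
    MBdd ν fun t => if p t then F t else G t := by
  refine ((MBdd.smul (memLp_ite hp) hF).add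
    (MBdd.smul (memLp_ite (p := fun t => ¬ p t) hp.compl) hG)).congr
    (Filter.Eventually.of_forall fun t => ?_)
  by_cases h : p t <;> simp [h]

end Scalars

/-! ### Integrals over subintervals as weighted integrals over [0, L] -/

namespace System

variable {n m q : ℕ} (S : System n m q) {ι κ : Type*}

theorem ae_mem : ∀ᵐ t ∂S.μ, t ∈ Icc 0 S.L := ae_restrict_mem measurableSet_Icc

theorem ae_mem_prod : ∀ᵐ p ∂(S.μ.prod S.μ), p ∈ Icc 0 S.L ×ˢ Icc 0 S.L := by
  rw [Measure.prod_restrict]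
  exact ae_restrict_mem (measurableSet_Icc.prod measurableSet_Icc)

theorem memLp_cont {f : ℝ → ℝ} (hf : Continuous f) : MemLp f ⊤ S.μ :=
  memLp_continuous isCompact_Icc S.ae_mem hf

theorem mint_eq_Ioc {a b : ℝ} (ha : 0 ≤ a) (hab : a ≤ b) (hb : b ≤ S.L)
    (F : ℝ → Matrix ι κ ℝ) :
    mint a b F = mI S.μ fun t => (if a < t ∧ t ≤ b then (1 : ℝ) else 0) • F t := by
  ext i j
  have h : (fun t => ((if a < t ∧ t ≤ b then (1 : ℝ) else 0) • F t) i j) =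
      (Ioc a b).indicator fun t => F t i j := by
    funext t
    by_cases ht : a < t ∧ t ≤ b <;> simp [indicator, ht]
  simp only [mint, mI, Matrix.of_apply, h]
  rw [setIntegral_indicator measurableSet_Ioc, intervalIntegral.integral_of_le hab,
    inter_eq_self_of_subset_right]
  exact fun t ht => ⟨ha.trans ht.1.le, ht.2.trans hb⟩

theorem mint_eq_Ioo {a b : ℝ} (ha : 0 ≤ a) (hab : a ≤ b) (hb : b ≤ S.L)
    (F : ℝ → Matrix ι κ ℝ) :
    mint a b F = mI S.μ fun t => (if a < t ∧ t < b then (1 : ℝ) else 0) • F t := by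
  ext i j
  have h : (fun t => ((if a < t ∧ t < b then (1 : ℝ) else 0) • F t) i j) =
      (Ioo a b).indicator fun t => F t i j := by
    funext t
    by_cases ht : a < t ∧ t < b <;> simp [indicator, ht]
  simp only [mint, mI, Matrix.of_apply, h]
  rw [setIntegral_indicator measurableSet_Ioo, intervalIntegral.integral_of_le hab,
    integral_Ioc_eq_integral_Ioo, inter_eq_self_of_subset_right]
  exact fun t ht => ⟨ha.trans ht.1.le, ht.2.le.trans hb⟩

theorem mint_eq_mI (hL : 0 ≤ S.L) (F : ℝ → Matrix ι κ ℝ) : mint 0 S.L F = mI S.μ F := by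
  ext i j
  simp only [mint, mI, Matrix.of_apply]
  rw [intervalIntegral.integral_of_le hL, integral_Icc_eq_integral_Ioc]

theorem mint_Ioc_L {a : ℝ} (ha : a ∈ Icc 0 S.L) (F : ℝ → Matrix ι κ ℝ) :
    mint a S.L F = mI S.μ fun t => (if a < t then (1 : ℝ) else 0) • F t := by
  rw [S.mint_eq_Ioc ha.1 ha.2 le_rfl]
  refine mI_congr (S.ae_mem.mono fun t ht => ?_)
  simp [ht.2]

theorem mint_Iic_0 {b : ℝ} (hb : b ∈ Icc 0 S.L) (F : ℝ → Matrix ι κ ℝ) :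
    mint 0 b F = mI S.μ fun t => (if t ≤ b then (1 : ℝ) else 0) • F t := by
  rw [S.mint_eq_Ioc le_rfl hb.1 hb.2]
  have h0 : ∀ᵐ t ∂S.μ, t ≠ 0 := ae_restrict_of_ae (Measure.ae_ne volume 0)
  refine mI_congr ?_
  filter_upwards [S.ae_mem, h0] with t ht h
  simp [lt_of_le_of_ne ht.1 h.symm]

theorem mint_Iio_0 {b : ℝ} (hb : b ∈ Icc 0 S.L) (F : ℝ → Matrix ι κ ℝ) :
    mint 0 b F = mI S.μ fun t => (if t < b then (1 : ℝ) else 0) • F t := by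
  rw [S.mint_eq_Ioo le_rfl hb.1 hb.2]
  have h0 : ∀ᵐ t ∂S.μ, t ≠ 0 := ae_restrict_of_ae (Measure.ae_ne volume 0)
  refine mI_congr ?_
  filter_upwards [S.ae_mem, h0] with t ht h
  simp [lt_of_le_of_ne ht.1 h.symm]

theorem mint_Ici_L {a : ℝ} (ha : a ∈ Icc 0 S.L) (F : ℝ → Matrix ι κ ℝ) :
    mint a S.L F = mI S.μ fun t => (if a ≤ t then (1 : ℝ) else 0) • F t := by
  rw [S.mint_Ioc_L ha]
  have h0 : ∀ᵐ t ∂S.μ, t ≠ a := ae_restrict_of_ae (Measure.ae_ne volume a)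
  refine mI_congr ?_
  filter_upwards [h0] with t h
  simp [lt_iff_le_and_ne, h.symm]

/-- The cut `c < t` is the one made by `Kernel.N` in its first variable; the cut `t < c` of the
companion lemma is the one in its second variable. The point `t = c` is null, but assigning it
consistently makes the integrands equal at every point. -/
theorem mint_add_mint_of_lt {c : ℝ} (hc : c ∈ Icc 0 S.L) {F G : ℝ → Matrix ι κ ℝ}
    (hF : MInt S.μ F) (hG : MInt S.μ G) :
    mint c S.L F + mint 0 c G = mI S.μ fun t => if c < t then F t else G t := by
  rw [S.mint_Ioc_L hc, S.mint_Iic_0 hc, ← mI_add (hF.smul (memLp_ite measurableSet_Ioi))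
    (hG.smul (memLp_ite measurableSet_Iic))]
  refine mI_congr (Filter.Eventually.of_forall fun t => ?_)
  by_cases h : c < t <;> simp [h, not_le.2, not_lt.1]

theorem mint_add_mint_of_gt {c : ℝ} (hc : c ∈ Icc 0 S.L) {F G : ℝ → Matrix ι κ ℝ}
    (hF : MInt S.μ F) (hG : MInt S.μ G) :
    mint 0 c F + mint c S.L G = mI S.μ fun t => if t < c then F t else G t := by
  rw [S.mint_Iio_0 hc, S.mint_Ici_L hc, ← mI_add (hF.smul (memLp_ite measurableSet_Iio))
    (hG.smul (memLp_ite measurableSet_Ici))]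
  refine mI_congr (Filter.Eventually.of_forall fun t => ?_)
  by_cases h : t < c <;> simp [h, not_le.2, not_lt.1]

end System

end PDEGain

/-! ### Regular kernels, Green's functions, and the map 𝓛₁ -/

namespace PDEGain

/-- The combined kernel of the integral part of `𝒫_{M,N₁,N₂}`. -/
def Kernel.N {n : ℕ} (K : Kernel n) (s θ : ℝ) : Mat n n := if θ < s then K.N1 s θ else K.N2 s θ

namespace System

variable {n m q : ℕ} (S : System n m q)

/-- Entrywise essential boundedness of a kernel, jointly and along all sections. -/
structure RegularKernel (K : Kernel n) : Prop where
  M : MBdd S.μ K.M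
  N1 : MBdd (S.μ.prod S.μ) fun p => K.N1 p.1 p.2
  N1_left : ∀ θ ∈ Icc 0 S.L, MBdd S.μ fun s => K.N1 s θ
  N1_right : ∀ s ∈ Icc 0 S.L, MBdd S.μ fun θ => K.N1 s θ
  N2 : MBdd (S.μ.prod S.μ) fun p => K.N2 p.1 p.2
  N2_left : ∀ θ ∈ Icc 0 S.L, MBdd S.μ fun s => K.N2 s θ
  N2_right : ∀ s ∈ Icc 0 S.L, MBdd S.μ fun θ => K.N2 s θ

/-- Entrywise continuity of a kernel. -/
structure _root_.PDEGain.Kernel.Cont (K : Kernel n) : Prop where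
  M : ∀ i j, Continuous fun s => K.M s i j
  N1 : ∀ i j, Continuous fun p : ℝ × ℝ => K.N1 p.1 p.2 i j
  N2 : ∀ i j, Continuous fun p : ℝ × ℝ => K.N2 p.1 p.2 i j

variable {S} in
-- In a section with θ fixed the factor `A θ` is a constant matrix, so every section stays bounded
-- although `A` itself is only essentially bounded.
theorem _root_.PDEGain.Kernel.Cont.mulRight {K : Kernel n} (hK : K.Cont) {A : ℝ → Mat n n}
    (hA : MBdd S.μ A) : S.RegularKernel (K.mulRight A) where
  M := ((Tame.of_continuous isCompact_Icc hK.M).mBdd S.ae_mem).mul hA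
  N1 := ((Tame.of_continuous (isCompact_Icc.prod isCompact_Icc) hK.N1).mBdd
    S.ae_mem_prod).mul hA.snd
  N1_left θ _ := ((Tame.of_continuous isCompact_Icc fun i j =>
    (hK.N1 i j).comp (by fun_prop : Continuous fun s : ℝ => (s, θ))).mBdd S.ae_mem).mul
      (MBdd.const _)
  N1_right s _ := ((Tame.of_continuous isCompact_Icc fun i j =>
    (hK.N1 i j).comp (by fun_prop : Continuous fun θ : ℝ => (s, θ))).mBdd S.ae_mem).mul hA
  N2 := ((Tame.of_continuous (isCompact_Icc.prod isCompact_Icc) hK.N2).mBdd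
    S.ae_mem_prod).mul hA.snd
  N2_left θ _ := ((Tame.of_continuous isCompact_Icc fun i j =>
    (hK.N2 i j).comp (by fun_prop : Continuous fun s : ℝ => (s, θ))).mBdd S.ae_mem).mul
      (MBdd.const _)
  N2_right s _ := ((Tame.of_continuous isCompact_Icc fun i j =>
    (hK.N2 i j).comp (by fun_prop : Continuous fun θ : ℝ => (s, θ))).mBdd S.ae_mem).mul hA

variable {S} in
theorem RegularKernel.N {K : Kernel n} (hK : S.RegularKernel K) :
    MBdd (S.μ.prod S.μ) fun p => K.N p.1 p.2 :=
  MBdd.ite (measurableSet_lt measurable_snd measurable_fst) hK.N1 hK.N2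

variable {S} in
theorem RegularKernel.N_left {K : Kernel n} (hK : S.RegularKernel K) {θ : ℝ}
    (hθ : θ ∈ Icc 0 S.L) : MBdd S.μ fun s => K.N s θ :=
  MBdd.ite measurableSet_Ioi (hK.N1_left θ hθ) (hK.N2_left θ hθ)

variable {S} in
theorem RegularKernel.N_right {K : Kernel n} (hK : S.RegularKernel K) {s : ℝ}
    (hs : s ∈ Icc 0 S.L) : MBdd S.μ fun θ => K.N s θ :=
  MBdd.ite measurableSet_Iio (hK.N1_right s hs) (hK.N2_right s hs)

/-! ### The Green's functions -/

theorem _root_.PDEGain.continuous_colBlk {Ω ι : Type*} [TopologicalSpace Ω] {c : Ω → ι → ℝ}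
    (hc : ∀ i, Continuous fun t => c t i) : Continuous fun t => colBlk n (c t) :=
  continuous_matrix fun p _ => (hc p.1).mul continuous_const

theorem _root_.PDEGain.continuous_rowBlk {Ω ι : Type*} [TopologicalSpace Ω] {c : Ω → ι → ℝ}
    (hc : ∀ i, Continuous fun t => c t i) : Continuous fun t => rowBlk n (c t) :=
  continuous_matrix fun _ p => (hc p.1).mul continuous_const

theorem continuous_bdryCol : Continuous fun η : ℝ => colBlk n ![0, S.L - η, 0, 1] :=
  continuous_colBlk fun i => by fin_cases i <;> simp <;> fun_prop

theorem continuous_Bc : Continuous S.Bc :=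
  (continuous_const.matrix_mul (continuous_const.matrix_mul S.continuous_bdryCol)).neg

theorem continuous_Ba : Continuous fun p : ℝ × ℝ => S.Ba p.1 p.2 :=
  (continuous_rowBlk fun i => by fin_cases i <;> simp <;> fun_prop).matrix_mul
    (S.continuous_Bc.comp continuous_snd)

theorem continuous_Bb : Continuous S.Bb := continuous_const.matrix_mul S.continuous_Bc

theorem continuous_Ba_left (η : ℝ) : Continuous fun s => S.Ba s η :=
  S.continuous_Ba.comp (by fun_prop : Continuous fun s : ℝ => (s, η))

/-- The common form `Φ(s,η) + 𝓘(s-η) φ(s-η)` of the Green's functions of `x` and `x_s`. -/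
def green (Φ : ℝ → ℝ → Mat n n) (φ : ℝ → ℝ) (s η : ℝ) : Mat n n :=
  Φ s η + (ind (s - η) * φ (s - η)) • (1 : Mat n n)

theorem G_eq_green : S.G = green S.Ba fun r => r := rfl

theorem Gs_eq_green : S.Gs = green (fun _ => S.Bb) fun _ => 1 := by
  funext s η
  simp [green, Gs]

theorem measurable_ind : Measurable ind :=
  Measurable.ite measurableSet_Ici measurable_const measurable_const

theorem abs_ind_le (r : ℝ) : |ind r| ≤ 1 := by
  unfold ind
  split_ifs <;> simp

theorem tame_of_continuous {Φ : ℝ → ℝ → Mat n n} (hΦ : Continuous fun p : ℝ × ℝ => Φ p.1 p.2) :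
    Tame (Icc 0 S.L ×ˢ Icc 0 S.L) fun p => Φ p.1 p.2 :=
  Tame.of_continuous (isCompact_Icc.prod isCompact_Icc) fun i j => hΦ.matrix_elem i j

theorem tame_green {Φ : ℝ → ℝ → Mat n n} (hΦ : Continuous fun p : ℝ × ℝ => Φ p.1 p.2)
    {φ : ℝ → ℝ} (hφ : Continuous φ) :
    Tame (Icc 0 S.L ×ˢ Icc 0 S.L) fun p => green Φ φ p.1 p.2 := by
  have hc : Continuous fun p : ℝ × ℝ => φ (p.1 - p.2) := by fun_prop
  obtain ⟨C, hC⟩ := (isCompact_Icc.prod isCompact_Icc).exists_bound_of_continuousOn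
    (hc.continuousOn (s := Icc 0 S.L ×ˢ Icc 0 S.L))
  refine (S.tame_of_continuous hΦ).add (Tame.smul (c := C)
    ((measurable_ind.comp (by fun_prop)).mul hc.measurable) (fun p hp => ?_) (Tame.const _ _))
  change |ind _ * φ _| ≤ C
  rw [abs_mul]
  calc _ ≤ 1 * C := mul_le_mul (abs_ind_le _) (hC p hp) (abs_nonneg _) zero_le_one
    _ = C := one_mul C

theorem tame_G : Tame (Icc 0 S.L ×ˢ Icc 0 S.L) fun p => S.G p.1 p.2 :=
  S.tame_green S.continuous_Ba continuous_id

theorem tame_Gs : Tame (Icc 0 S.L ×ˢ Icc 0 S.L) fun p => S.Gs p.1 p.2 := by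
  rw [Gs_eq_green]
  exact S.tame_green (S.continuous_Bb.comp continuous_snd) continuous_const

variable {S} in
theorem _root_.PDEGain.Tame.left {F : ℝ × ℝ → Mat n n} (hF : Tame (Icc 0 S.L ×ˢ Icc 0 S.L) F)
    {θ : ℝ} (hθ : θ ∈ Icc 0 S.L) : Tame (Icc 0 S.L) fun s => F (s, θ) :=
  hF.comp (by fun_prop) fun _ hs => ⟨hs, hθ⟩

variable {S} in
theorem _root_.PDEGain.Tame.right {F : ℝ × ℝ → Mat n n} (hF : Tame (Icc 0 S.L ×ˢ Icc 0 S.L) F)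
    {s : ℝ} (hs : s ∈ Icc 0 S.L) : Tame (Icc 0 S.L) fun θ => F (s, θ) :=
  hF.comp (by fun_prop) fun _ hθ => ⟨hs, hθ⟩

/-! ### The kernel of `⟨x, 𝒫 f⟩` in terms of `x_ss` and `f` -/

/-- The kernel with `⟨x, 𝒫 f⟩ = ∫∫ x_ss(s)ᵀ T(s,θ) f(θ)`. -/
def T (K : Kernel n) (s θ : ℝ) : Mat n n :=
  (S.G θ s)ᵀ * K.M θ + mI S.μ fun β => (S.G β s)ᵀ * K.N β θ

/-- The part of `T` not coming from the boundary conditions. -/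
def T₀ (K : Kernel n) (s θ : ℝ) : Mat n n :=
  (ind (θ - s) * (θ - s)) • K.M θ
    + mI S.μ fun β => (ind (β - s) * (β - s)) • K.N β θ

variable {S} {K : Kernel n}

theorem mBdd_Ba (s : ℝ) : MBdd S.μ fun β => (S.Ba β s)ᵀ :=
  ((Tame.of_continuous isCompact_Icc fun i j =>
    (S.continuous_Ba_left s).matrix_elem i j).mBdd S.ae_mem).transpose

theorem mBdd_G {s : ℝ} (hs : s ∈ Icc 0 S.L) : MBdd S.μ fun β => (S.G β s)ᵀ :=
  ((S.tame_G.left hs).mBdd S.ae_mem).transpose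

theorem memLp_ind_mul {φ : ℝ → ℝ} (hφ : Continuous φ) (s : ℝ) :
    MemLp (fun β => ind (β - s) * φ (β - s)) ⊤ S.μ :=
  (S.memLp_cont (f := fun β => φ (β - s)) (by fun_prop)).mul (memLp_ind (by fun_prop))

theorem Y1_eq (hK : S.RegularKernel K) (s : ℝ) {θ : ℝ} (hθ : θ ∈ Icc 0 S.L) :
    S.Y1 K s θ = (S.Ba θ s)ᵀ * K.M θ + mI S.μ fun β => (S.Ba β s)ᵀ * K.N β θ := by
  unfold Y1
  rw [add_assoc, S.mint_add_mint_of_lt hθ ((mBdd_Ba s).mul (hK.N1_left θ hθ)).mInt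
    ((mBdd_Ba s).mul (hK.N2_left θ hθ)).mInt]
  congr 2
  funext β
  unfold Kernel.N
  split_ifs <;> rfl

/-- Split `G` into `Ba` and the truncated power: `Y1` collects the part with `Ba`, `T₀` the rest. -/
theorem T_eq (hK : S.RegularKernel K) (s : ℝ) {θ : ℝ} (hθ : θ ∈ Icc 0 S.L) :
    S.T K s θ = S.Y1 K s θ + S.T₀ K s θ := by
  have h1 : MInt S.μ fun β => (S.Ba β s)ᵀ * K.N β θ := ((mBdd_Ba s).mul (hK.N_left hθ)).mInt
  have h2 : MInt S.μ fun β => (ind (β - s) * (β - s)) • K.N β θ :=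
    (MBdd.smul (memLp_ind_mul continuous_id s) (hK.N_left hθ)).mInt
  have h3 : ∀ β, (S.G β s)ᵀ * K.N β θ =
      (S.Ba β s)ᵀ * K.N β θ + (ind (β - s) * (β - s)) • K.N β θ := fun β => by
    simp [G, Matrix.add_mul]
  rw [Y1_eq hK s hθ, T₀, T]
  simp only [h3]
  rw [mI_add h1 h2]
  simp only [G, Matrix.transpose_add, Matrix.add_mul, Matrix.transpose_smul,
    Matrix.transpose_one, Matrix.smul_mul, Matrix.one_mul]
  abel

/-- Below the diagonal the truncated power kills the term with `M`, and every β > s also exceeds θ,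
so only `N1` contributes. -/
theorem L1_fst_eq (hK : S.RegularKernel K) {s θ : ℝ} (hs : s ∈ Icc 0 S.L) (hθ : θ ∈ Icc 0 S.L)
    (h : θ < s) : (S.L1 K).1 s θ = S.T K s θ := by
  rw [T_eq hK s hθ, add_comm]
  simp only [L1, E1, T₀]
  have h0 : ind (θ - s) = 0 := by simp [ind, h]
  rw [h0, zero_mul, zero_smul, zero_add, S.mint_Ioc_L hs]
  congr 2
  funext β
  rcases lt_trichotomy s β with hb | rfl | hb
  · simp [hb, ind, hb.le, Kernel.N, h.trans hb]
  · simp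
  · simp [ind, hb.not_ge, hb.not_gt]

/-- Above the diagonal the term with `M` survives, and the range β > s is cut at θ: `N2` acts up to
θ and `N1` beyond. -/
theorem L1_snd_eq (hK : S.RegularKernel K) {s θ : ℝ} (hs : s ∈ Icc 0 S.L) (hθ : θ ∈ Icc 0 S.L)
    (h : s < θ) : (S.L1 K).2 s θ = S.T K s θ := by
  rw [T_eq hK s hθ, add_comm]
  simp only [L1, E2, T₀]
  have h0 : ind (θ - s) = 1 := by simp [ind, h.le]
  have hc : MemLp (fun η => η - s) ⊤ S.μ := S.memLp_cont (by fun_prop)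
  congr 1
  rw [h0, one_mul, S.mint_Ioc_L hθ, S.mint_eq_Ioc hs.1 h.le hθ.2, add_assoc, ← mI_add
    (MBdd.smul (memLp_ite measurableSet_Ioi) (MBdd.smul hc (hK.N1_left θ hθ))).mInt
    (MBdd.smul (memLp_ite measurableSet_Ioc) (MBdd.smul hc (hK.N2_left θ hθ))).mInt]
  congr 2
  funext β
  rcases lt_trichotomy s β with hb | rfl | hb
  · by_cases hb' : θ < β
    · simp [hb, hb.le, ind, hb', hb'.not_ge, Kernel.N]
    · simp [hb, hb.le, ind, hb', not_lt.1 hb', Kernel.N]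
  · simp [h.not_gt]
  · simp [ind, hb.not_ge, hb.not_gt, (hb.trans h).not_gt]

end System

end PDEGain

/-! ### Composition of `T` with the Green's functions, and the maps 𝓛₂ and 𝓛₃ -/

namespace PDEGain
namespace System

variable {n m q : ℕ} {S : System n m q} {K : Kernel n} {κ : Type*}

variable (S) in
/-- The operator `𝒫` applied to the columns of a matrix function; the common form of `Y₂ B_b`
and `Y₃`. -/
def Y (K : Kernel n) (Φ : ℝ → Matrix (Fin n) κ ℝ) (ζ : ℝ) : Matrix (Fin n) κ ℝ :=
  K.M ζ * Φ ζ + (mint 0 ζ fun θ => K.N1 ζ θ * Φ θ) + mint ζ S.L fun θ => K.N2 ζ θ * Φ θ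

variable (S) in
/-- The common form of `F₃` and `G₃`. -/
def tail (K : Kernel n) (Φ : ℝ → Mat n n) (φ : ℝ → ℝ) (s θ : ℝ) : Mat n n :=
  (mI S.μ fun ζ => (S.Ba ζ s)ᵀ * S.Y K Φ ζ) + (mint θ S.L fun ζ => φ (ζ - θ) • S.Y1 K s ζ)
    + mint s S.L fun ζ => (ζ - s) • S.Y K Φ ζ

variable (S) in
/-- The common form of `F₁`, `F₂`, `G₁` and `G₂`, which differ in the lower limit `a`. -/
def head (K : Kernel n) (φ : ℝ → ℝ) (a s θ : ℝ) : Mat n n :=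
  mint a S.L fun η => (η - s) • (φ (η - θ) • K.M η + mint θ η fun ζ => φ (ζ - θ) • K.N1 η ζ)
    + mint s η fun ζ => ((ζ - s) * φ (η - θ)) • K.N2 ζ η

theorem Y_eq (hK : S.RegularKernel K) {Φ : ℝ → Matrix (Fin n) κ ℝ} (hΦ : MInt S.μ Φ) {ζ : ℝ}
    (hζ : ζ ∈ Icc 0 S.L) :
    S.Y K Φ ζ = K.M ζ * Φ ζ + mI S.μ fun θ => K.N ζ θ * Φ θ := by
  unfold Y
  rw [add_assoc, S.mint_add_mint_of_gt hζ ((hK.N1_right ζ hζ).mul_mInt hΦ)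
    ((hK.N2_right ζ hζ).mul_mInt hΦ)]
  congr 2
  funext β
  unfold Kernel.N
  split_ifs <;> rfl

theorem mInt_Y (hK : S.RegularKernel K) {Φ : ℝ → Matrix (Fin n) κ ℝ} (hΦ : MInt S.μ Φ) :
    MInt S.μ (S.Y K Φ) := by
  refine ((hK.M.mul_mInt hΦ).add (MInt.integral (ν' := S.μ) (F := fun ζ θ => K.N ζ θ * Φ θ)
    (hK.N.mul_mInt hΦ.snd))).congr (S.ae_mem.mono fun ζ hζ => ?_)
  exact (Y_eq hK hΦ hζ).symm

theorem mBdd_Y (hK : S.RegularKernel K) {Φ : ℝ → Mat n n} (hΦ : MBdd S.μ Φ) :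
    MBdd S.μ (S.Y K Φ) := by
  refine ((hK.M.mul hΦ).add (MBdd.integral (ν' := S.μ) (F := fun ζ θ => K.N ζ θ * Φ θ)
    (hK.N.mul hΦ.snd))).congr (S.ae_mem.mono fun ζ hζ => ?_)
  exact (Y_eq hK hΦ.mInt hζ).symm

theorem mBdd_Y1 (hK : S.RegularKernel K) (s : ℝ) : MBdd S.μ fun ζ => S.Y1 K s ζ := by
  refine (((mBdd_Ba s).mul hK.M).add (MBdd.integral (ν' := S.μ)
    (F := fun ζ β => (S.Ba β s)ᵀ * K.N β ζ)
    ((mBdd_Ba s).snd.mul hK.N.swap))).congr (S.ae_mem.mono fun ζ hζ => ?_)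
  exact (Y1_eq hK s hζ).symm

theorem mBdd_T₀ (hK : S.RegularKernel K) (s : ℝ) : MBdd S.μ fun ζ => S.T₀ K s ζ :=
  (MBdd.smul (memLp_ind_mul continuous_id s) hK.M).add (MBdd.integral (ν' := S.μ)
    (F := fun ζ β => (ind (β - s) * (β - s)) • K.N β ζ)
    (MBdd.smul ((memLp_ind_mul continuous_id s).comp_snd _) hK.N.swap))

theorem mBdd_T_right (hK : S.RegularKernel K) (s : ℝ) :
    MBdd S.μ fun ζ => S.T K s ζ :=
  ((mBdd_Y1 hK s).add (mBdd_T₀ hK s)).congr (S.ae_mem.mono fun _ hζ => (T_eq hK s hζ).symm)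

/-- `∫ T(s,ζ) Φ(ζ) dζ` is obtained by applying first `𝒫` and then the transposed Green's
function. -/
theorem mI_T_mul (hK : S.RegularKernel K) {Φ : ℝ → Matrix (Fin n) κ ℝ} (hΦ : MInt S.μ Φ) {s : ℝ}
    (hs : s ∈ Icc 0 S.L) :
    (mI S.μ fun ζ => S.T K s ζ * Φ ζ) = mI S.μ fun ζ => (S.G ζ s)ᵀ * S.Y K Φ ζ := by
  have hG := mBdd_G hs
  have h2 : MInt (S.μ.prod S.μ) fun p : ℝ × ℝ => (S.G p.2 s)ᵀ * K.N p.2 p.1 * Φ p.1 :=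
    (hG.snd.mul hK.N.swap).mul_mInt hΦ.fst
  have h3 : MInt (S.μ.prod S.μ) fun p : ℝ × ℝ => (S.G p.1 s)ᵀ * (K.N p.1 p.2 * Φ p.2) :=
    hG.fst.mul_mInt (hK.N.mul_mInt hΦ.snd)
  have e1 : ∀ ζ ∈ Icc 0 S.L, S.T K s ζ * Φ ζ = (S.G ζ s)ᵀ * K.M ζ * Φ ζ
      + mI S.μ fun β => (S.G β s)ᵀ * K.N β ζ * Φ ζ := fun ζ hζ => by
    rw [T, Matrix.add_mul, mI_mul_const (hG.mul (hK.N_left hζ)).mInt]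
  have e2 : ∀ ζ ∈ Icc 0 S.L, (S.G ζ s)ᵀ * S.Y K Φ ζ = (S.G ζ s)ᵀ * K.M ζ * Φ ζ
      + mI S.μ fun θ => (S.G ζ s)ᵀ * (K.N ζ θ * Φ θ) := fun ζ hζ => by
    rw [Y_eq hK hΦ hζ, Matrix.mul_add, mI_const_mul _ ((hK.N_right hζ).mul_mInt hΦ),
      Matrix.mul_assoc]
  rw [mI_congr (S.ae_mem.mono e1), mI_congr (S.ae_mem.mono e2),
    mI_add ((hG.mul hK.M).mul_mInt hΦ) (MInt.integral h2),
    mI_add ((hG.mul hK.M).mul_mInt hΦ) (MInt.integral h3), mI_swap h2]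
  simp only [Matrix.mul_assoc]

theorem mI_G_mul_Y (hK : S.RegularKernel K) {Φ : ℝ → Mat n n} (hΦ : MBdd S.μ Φ) {s : ℝ}
    (hs : s ∈ Icc 0 S.L) :
    (mI S.μ fun ζ => (S.G ζ s)ᵀ * S.Y K Φ ζ)
      = (mI S.μ fun ζ => (S.Ba ζ s)ᵀ * S.Y K Φ ζ) + mint s S.L fun ζ => (ζ - s) • S.Y K Φ ζ := by
  have hY := mBdd_Y hK hΦ
  rw [S.mint_Ici_L hs, ← mI_add ((mBdd_Ba s).mul hY).mInt
    (MBdd.smul (memLp_ite measurableSet_Ici) (MBdd.smul (S.memLp_cont (by fun_prop)) hY)).mInt]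
  congr 1
  funext ζ
  simp only [G, Matrix.transpose_add, Matrix.add_mul, Matrix.transpose_smul,
    Matrix.transpose_one, Matrix.smul_mul, Matrix.one_mul, smul_smul, ind, sub_nonneg]

/-- With f the weight truncated at θ and g the one truncated at s, the left side is a sum of
integrals of f(ζ)g(β) against `M` on the diagonal and `N1`, `N2` on the two triangles. Taking the
larger of ζ and β as the outer variable η, each integrand vanishes unless η > max(s, θ). This is why
the formulas for the two triangles share their integrand and differ only in the lower limit. -/
theorem mI_ind_T₀ (hK : S.RegularKernel K) {φ : ℝ → ℝ} (hφ : Continuous φ) {s θ : ℝ}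
    (hs : s ∈ Icc 0 S.L) (hθ : θ ∈ Icc 0 S.L) :
    (mint θ S.L fun ζ => φ (ζ - θ) • S.T₀ K s ζ) = S.head K φ (max s θ) s θ := by
  set f : ℝ → ℝ := fun ζ => (if θ < ζ then 1 else 0) * φ (ζ - θ)
  set g : ℝ → ℝ := fun β => ind (β - s) * (β - s)
  have hf : MemLp f ⊤ S.μ :=
    (S.memLp_cont (f := fun ζ => φ (ζ - θ)) (by fun_prop)).mul (memLp_ite measurableSet_Ioi)
  have hg : MemLp g ⊤ S.μ := memLp_ind_mul continuous_id s
  have hlt : MeasurableSet {p : ℝ × ℝ | p.2 < p.1} := measurableSet_lt measurable_snd measurable_fst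
  have hlt' : MeasurableSet {p : ℝ × ℝ | p.1 < p.2} :=
    measurableSet_lt measurable_fst measurable_snd
  have hge : MeasurableSet {p : ℝ × ℝ | p.2 ≤ p.1} := measurableSet_le measurable_snd measurable_fst
  have hgf : ∀ u v : ℝ × ℝ → ℝ, MemLp u ⊤ (S.μ.prod S.μ) → MemLp v ⊤ (S.μ.prod S.μ) →
      MemLp (fun p => v p * u p) ⊤ (S.μ.prod S.μ) := fun u v hu hv => hu.mul hv
  have m0 : MBdd S.μ fun ζ => (f ζ * g ζ) • K.M ζ := MBdd.smul (MemLp.mul (r := ⊤) hg hf) hK.M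
  have m1 : MBdd (S.μ.prod S.μ) fun p : ℝ × ℝ =>
      (f p.1 * g p.2 * if p.1 < p.2 then 1 else 0) • K.N1 p.2 p.1 :=
    MBdd.smul ((memLp_ite hlt').mul (hgf _ _ (hg.comp_snd _) (hf.comp_fst _))) hK.N1.swap
  have m1' : MBdd (S.μ.prod S.μ) fun p : ℝ × ℝ =>
      (f p.2 * g p.1 * if p.2 < p.1 then 1 else 0) • K.N1 p.1 p.2 :=
    MBdd.smul ((memLp_ite hlt).mul (hgf _ _ (hg.comp_fst _) (hf.comp_snd _))) hK.N1
  have m2 : MBdd (S.μ.prod S.μ) fun p : ℝ × ℝ =>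
      (f p.1 * g p.2 * if p.2 ≤ p.1 then 1 else 0) • K.N2 p.2 p.1 :=
    MBdd.smul ((memLp_ite hge).mul (hgf _ _ (hg.comp_snd _) (hf.comp_fst _))) hK.N2.swap
  have lhs : (mint θ S.L fun ζ => φ (ζ - θ) • S.T₀ K s ζ) = (mI S.μ fun ζ => (f ζ * g ζ) • K.M ζ)
      + (mI S.μ fun ζ => mI S.μ fun β => (f ζ * g β * if ζ < β then 1 else 0) • K.N1 β ζ)
      + mI S.μ fun ζ => mI S.μ fun β => (f ζ * g β * if β ≤ ζ then 1 else 0) • K.N2 β ζ := by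
    rw [S.mint_Ioc_L hθ, ← mI_add m0.mInt (MInt.integral m1.mInt),
      ← mI_add (m0.mInt.add (MInt.integral m1.mInt)) (MInt.integral m2.mInt)]
    refine mI_congr (S.ae_mem.mono fun ζ hζ => ?_)
    have k1 : MBdd S.μ fun β => (f ζ * g β * if ζ < β then 1 else 0) • K.N1 β ζ :=
      MBdd.smul ((memLp_ite measurableSet_Ioi).mul (hg.const_mul _)) (hK.N1_left ζ hζ)
    have k2 : MBdd S.μ fun β => (f ζ * g β * if β ≤ ζ then 1 else 0) • K.N2 β ζ :=
      MBdd.smul ((memLp_ite measurableSet_Iic).mul (hg.const_mul _)) (hK.N2_left ζ hζ)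
    rw [add_assoc, ← mI_add k1.mInt k2.mInt, T₀, smul_smul, smul_add, smul_smul, ← mI_smul]
    congr 2
    funext β
    by_cases h : ζ < β
    · simp [Kernel.N, h, h.not_ge, f, g, smul_smul]
    · simp [Kernel.N, h, not_lt.1 h, f, g, smul_smul]
  -- In the term with `N1` the larger variable is β, so Fubini makes it the outer one; in the term
  -- with `N2` it already is.
  rw [lhs, mI_swap m1.mInt]
  unfold head
  rw [S.mint_Ioc_L ⟨hs.1.trans (le_max_left _ _), max_le hs.2 hθ.2⟩,
    ← mI_add m0.mInt (MInt.integral m1'.mInt),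
    ← mI_add (m0.mInt.add (MInt.integral m1'.mInt)) (MInt.integral m2.mInt)]
  refine mI_congr (S.ae_mem.mono fun η hη => ?_)
  by_cases h : max s θ < η
  · have hsη : s < η := (le_max_left _ _).trans_lt h
    have hθη : θ < η := (le_max_right _ _).trans_lt h
    have hgη : g η = η - s := by simp [g, ind, hsη.le]
    have hfη : f η = φ (η - θ) := by simp [f, hθη]
    rw [if_pos h, one_smul, S.mint_eq_Ioo hθ.1 hθη.le hη.2, S.mint_eq_Ioc hs.1 hsη.le hη.2,
      smul_add, smul_smul, ← mI_smul, hgη, hfη]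
    congr 2
    · rw [mul_comm]
    · congr 1
      funext ζ
      simp only [smul_smul, f]
      congr 1
      by_cases h1 : θ < ζ <;> by_cases h2 : ζ < η <;> simp [h1, h2]
      ring
    · funext ζ
      simp only [smul_smul, g]
      congr 1
      rcases lt_trichotomy s ζ with h1 | rfl | h1
      · by_cases h2 : ζ ≤ η <;> simp [h1, h2, h1.le, ind]
        ring
      · simp
      · simp [h1.not_gt, h1.not_ge, ind]
  -- Outside the range η > max(s, θ) either f vanishes or the only point left is s, where g(s) = 0.
  · have hfg : ∀ β, s ≤ β → β ≤ η → f η * g β = 0 := fun β h1 h2 => by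
      by_cases h3 : θ < η
      · have h4 : η ≤ s := by
          by_contra h4
          exact h (max_lt (not_le.1 h4) h3)
        have : β = s := le_antisymm (h2.trans h4) h1
        simp [g, this]
      · simp [f, h3]
    have e1 : ∀ ζ, (f ζ * g η * if ζ < η then 1 else 0) = 0 := fun ζ => by
      by_cases h1 : θ < ζ
      · by_cases h2 : ζ < η
        · have h3 : η ≤ s := by
            by_contra h4
            exact h (max_lt (not_le.1 h4) (h1.trans h2))
          rcases h3.eq_or_lt with rfl | h3
          · simp [g]
          · simp [g, ind, h3]
        · simp [h2]
      · simp [f, h1]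
    have e2 : ∀ β, (f η * g β * if β ≤ η then 1 else 0) = 0 := fun β => by
      by_cases h1 : β ≤ η
      · by_cases h2 : s ≤ β
        · simp [hfg β h2 h1]
        · simp [g, ind, h2]
      · simp [h1]
    have e0 : f η * g η = 0 := by
      have := e2 η
      simpa using this
    simp [h, e0, e1, e2, mI_zero]

/-- The kernel obtained by composing `T` with a Green's function. -/
theorem mI_T_mul_green (hK : S.RegularKernel K) {Φ : ℝ → ℝ → Mat n n} {φ : ℝ → ℝ}
    (hφ : Continuous φ) {s θ : ℝ} (hΦ : MBdd S.μ fun ζ => Φ ζ θ)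
    (hs : s ∈ Icc 0 S.L) (hθ : θ ∈ Icc 0 S.L) :
    (mI S.μ fun ζ => S.T K s ζ * green Φ φ ζ θ)
      = S.head K φ (max s θ) s θ + S.tail K (fun ζ => Φ ζ θ) φ s θ := by
  have hT := mBdd_T_right hK s
  have hc : MemLp (fun ζ => φ (ζ - θ)) ⊤ S.μ := S.memLp_cont (by fun_prop)
  have hi : MemLp (fun ζ => if θ ≤ ζ then (1 : ℝ) else 0) ⊤ S.μ := memLp_ite measurableSet_Ici
  have e : ∀ ζ, S.T K s ζ * green Φ φ ζ θ = S.T K s ζ * Φ ζ θ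
      + (ind (ζ - θ) * φ (ζ - θ)) • S.T K s ζ := fun ζ => by
    simp [green, Matrix.mul_add]
  simp only [e]
  rw [mI_add (hT.mul hΦ).mInt (MBdd.smul (memLp_ind_mul hφ θ) hT).mInt, mI_T_mul hK hΦ.mInt hs,
    mI_G_mul_Y hK hΦ hs, ← mI_ind_T₀ hK hφ hs hθ, tail, S.mint_Ici_L hθ, S.mint_Ici_L hθ]
  -- The truncated part of the right factor meets both parts of `T`: the one with `T₀` is the head,
  -- the one with `Y1` belongs to the tail.
  have e2 : (mI S.μ fun ζ => (ind (ζ - θ) * φ (ζ - θ)) • S.T K s ζ)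
      = (mI S.μ fun ζ => (if θ ≤ ζ then (1 : ℝ) else 0) • φ (ζ - θ) • S.T₀ K s ζ)
        + mI S.μ fun ζ => (if θ ≤ ζ then (1 : ℝ) else 0) • φ (ζ - θ) • S.Y1 K s ζ := by
    rw [← mI_add (MBdd.smul hi (MBdd.smul hc (mBdd_T₀ hK s))).mInt
      (MBdd.smul hi (MBdd.smul hc (mBdd_Y1 hK s))).mInt]
    refine mI_congr (S.ae_mem.mono fun ζ hζ => ?_)
    simp only [T_eq hK s hζ, ind, sub_nonneg, smul_smul, smul_add]
    abel
  rw [e2]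
  abel

theorem L3_fst_eq (hK : S.RegularKernel K) {s θ : ℝ} (hs : s ∈ Icc 0 S.L) (hθ : θ ∈ Icc 0 S.L)
    (h : θ < s) : (S.L3 K).1 s θ = mI S.μ fun ζ => S.T K s ζ * S.G ζ θ := by
  rw [G_eq_green, mI_T_mul_green (Φ := S.Ba) (φ := fun r => r) hK continuous_id (mBdd_Ba θ).transpose hs hθ, max_eq_left h.le]
  simp only [L3, G3, S.mint_eq_mI (hs.1.trans hs.2)]
  rfl

theorem L3_snd_eq (hK : S.RegularKernel K) {s θ : ℝ} (hs : s ∈ Icc 0 S.L) (hθ : θ ∈ Icc 0 S.L)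
    (h : s < θ) : (S.L3 K).2 s θ = mI S.μ fun ζ => S.T K s ζ * S.G ζ θ := by
  rw [G_eq_green, mI_T_mul_green (Φ := S.Ba) (φ := fun r => r) hK continuous_id (mBdd_Ba θ).transpose hs hθ, max_eq_right h.le]
  simp only [L3, G3, S.mint_eq_mI (hs.1.trans hs.2)]
  rfl

theorem Y_const (hK : S.RegularKernel K) (A : Mat n n) {ζ : ℝ} (hζ : ζ ∈ Icc 0 S.L) :
    S.Y K (fun _ => A) ζ = S.Y2 K ζ * A := by
  have h1 := hK.N1_right ζ hζ
  have h2 := hK.N2_right ζ hζ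
  rw [Y, Y2, add_assoc, add_assoc, S.mint_add_mint_of_gt hζ h1.mInt h2.mInt,
    S.mint_add_mint_of_gt hζ (h1.mInt.mul_const A) (h2.mInt.mul_const A), Matrix.add_mul,
    ← mI_mul_const (MBdd.ite measurableSet_Iio h1 h2).mInt]
  congr 2
  funext t
  split_ifs <;> rfl

theorem mBdd_Y2 (hK : S.RegularKernel K) : MBdd S.μ (S.Y2 K) :=
  (mBdd_Y hK (MBdd.const 1)).congr (S.ae_mem.mono fun ζ hζ => by
    rw [Y_const hK 1 hζ, Matrix.mul_one])

/-- The continuous part of the Green's function of x_s does not depend on its first argument, so it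
factors out of 𝒫 and leaves `Y2`. -/
theorem tail_const (hK : S.RegularKernel K) {s θ : ℝ} (hs : s ∈ Icc 0 S.L) :
    S.tail K (fun _ => S.Bb θ) (fun _ => 1) s θ = S.F3 K s θ := by
  have hY := mBdd_Y2 hK
  simp only [tail, F3, S.mint_eq_mI (hs.1.trans hs.2), one_smul, S.mint_Ioc_L hs]
  rw [← mI_mul_const (MBdd.smul (memLp_ite measurableSet_Ioi)
    (MBdd.smul (S.memLp_cont (by fun_prop)) hY)).mInt]
  congr 1
  · congr 1
    exact mI_congr (S.ae_mem.mono fun ζ hζ => by rw [Y_const hK _ hζ, Matrix.mul_assoc])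
  · exact mI_congr (S.ae_mem.mono fun ζ hζ => by
      rw [Y_const hK _ hζ, Matrix.smul_mul, Matrix.smul_mul])

theorem L2_fst_eq (hK : S.RegularKernel K) {s θ : ℝ} (hs : s ∈ Icc 0 S.L) (hθ : θ ∈ Icc 0 S.L)
    (h : θ < s) : (S.L2 K).1 s θ = mI S.μ fun ζ => S.T K s ζ * S.Gs ζ θ := by
  rw [Gs_eq_green, mI_T_mul_green (Φ := fun _ => S.Bb) (φ := fun _ => 1) hK continuous_const (MBdd.const _) hs hθ, max_eq_left h.le,
    tail_const hK hs]
  simp only [L2, F1, head, F4, F5, one_smul, mul_one]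

theorem L2_snd_eq (hK : S.RegularKernel K) {s θ : ℝ} (hs : s ∈ Icc 0 S.L) (hθ : θ ∈ Icc 0 S.L)
    (h : s < θ) : (S.L2 K).2 s θ = mI S.μ fun ζ => S.T K s ζ * S.Gs ζ θ := by
  rw [Gs_eq_green, mI_T_mul_green (Φ := fun _ => S.Bb) (φ := fun _ => 1) hK continuous_const (MBdd.const _) hs hθ, max_eq_right h.le,
    tail_const hK hs]
  simp only [L2, F2, head, F4, F5, one_smul, mul_one]

end System
end PDEGain

/-! ### Representation of x, x_s, the boundary values and the output by x_ss -/

namespace PDEGain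

section Columns

variable {α : Type*} [MeasurableSpace α] {ν : Measure α} {a b n : ℕ}

/-- A vector as a matrix with one column. -/
def col (v : E n) : Matrix (Fin n) Unit ℝ := Matrix.of fun i _ => v i

theorem col_add (v w : E n) : col (v + w) = col v + col w := rfl

theorem col_smul (c : ℝ) (v : E n) : col (c • v) = c • col v := rfl

theorem col_act (A : Mat a b) (v : E b) : col (act A v) = A * col v := rfl

theorem inner_eq_col (v w : E n) : inner ℝ v w = ((col v)ᵀ * col w) () () := by
  simp [PiLp.inner_apply, Matrix.mul_apply, col, mul_comm]

theorem mInt_col {f : α → E n} (hf : Integrable f ν) : MInt ν fun t => col (f t) :=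
  fun i _ => (EuclideanSpace.proj (𝕜 := ℝ) i).integrable_comp hf

theorem MInt.integrable {f : α → E n} (hf : MInt ν fun t => col (f t)) : Integrable f ν :=
  Integrable.of_eval_piLp fun i => hf i ()

theorem col_integral {f : α → E n} (hf : Integrable f ν) :
    col (∫ t, f t ∂ν) = mI ν fun t => col (f t) := by
  ext i j
  exact ((EuclideanSpace.proj (𝕜 := ℝ) i).integral_comp_comm hf).symm

theorem col_intervalIntegral {f : ℝ → E n} {s t : ℝ} (hf : IntervalIntegrable f volume s t) :
    col (∫ r in s..t, f r) = mint s t fun r => col (f r) := by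
  ext i j
  exact ((EuclideanSpace.proj (𝕜 := ℝ) i).intervalIntegral_comp_comm hf).symm

theorem mI_smul_const {ι κ : Type*} (f : α → ℝ) (A : Matrix ι κ ℝ) :
    (mI ν fun t => f t • A) = (∫ t, f t ∂ν) • A := by
  ext i j
  exact integral_mul_const _ _

theorem blk_mul {ι κ ρ : Type*} [Fintype κ] (c : Matrix ι κ ℝ)
    (A : Matrix (κ × Fin n) ρ ℝ) (i : ι) (k : Fin n) (r : ρ) :
    (blk n c * A) (i, k) r = ∑ j, c i j * A (j, k) r := by
  simp [blk, Matrix.mul_apply, Fintype.sum_prod_type, Matrix.one_apply]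

theorem rowBlk_mul {κ ρ : Type*} [Fintype κ] (c : κ → ℝ)
    (A : Matrix (κ × Fin n) ρ ℝ) (k : Fin n) (r : ρ) :
    (rowBlk n c * A) k r = ∑ j, c j * A (j, k) r := by
  simp [rowBlk, Matrix.mul_apply, Fintype.sum_prod_type, Matrix.one_apply]

theorem colBlk_mul {ι ρ : Type*} (c : ι → ℝ)
    (A : Matrix (Fin n) ρ ℝ) (i : ι) (k : Fin n) (r : ρ) :
    (colBlk n c * A) (i, k) r = c i * A k r := by
  simp [colBlk, Matrix.mul_apply, Matrix.one_apply]

end Columns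

namespace System

variable {n m q : ℕ} {S : System n m q} {K : Kernel n} {u us uss : ℝ → E n}

theorem intervalIntegrable {F : Type*} [NormedAddCommGroup F] {f : ℝ → F}
    (hf : Integrable f S.μ) {a b : ℝ} (ha : a ∈ Icc 0 S.L) (hb : b ∈ Icc 0 S.L) :
    IntervalIntegrable f volume a b := by
  have h : IntegrableOn f (Icc 0 S.L) volume := hf
  exact (h.mono_set (uIcc_subset_Icc ha hb)).intervalIntegrable

theorem IsState.mInt (h : S.IsState u us uss) : MInt S.μ fun t => col (uss t) :=
  mInt_col (h.memLp.integrable one_le_two)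

/-- The integrand is the indicator of [η, s]. Integrating the truncation in the formula for x_s thus
gives the Taylor remainder kernel in the formula for x. -/
theorem integral_ind_sub {s η : ℝ} (hs : s ∈ Icc 0 S.L) (hη : η ∈ Icc 0 S.L) :
    ∫ r, (if r ≤ s then 1 else 0) * ind (r - η) ∂S.μ = ind (s - η) * (s - η) := by
  have h : (fun r => (if r ≤ s then 1 else 0) * ind (r - η))
      = (Icc η s).indicator fun _ => (1 : ℝ) := by
    funext r
    by_cases h1 : r ≤ s <;> by_cases h2 : η ≤ r <;> simp [indicator, ind, h1, h2]
  rw [h, setIntegral_indicator measurableSet_Icc, inter_eq_self_of_subset_right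
    (Icc_subset_Icc hη.1 hs.2)]
  by_cases h1 : η ≤ s
  · simp [ind, h1]
  · simp [ind, h1]

theorem integral_le_indicator {s : ℝ} (hs : s ∈ Icc 0 S.L) :
    ∫ r, (if r ≤ s then (1 : ℝ) else 0) ∂S.μ = s := by
  have h := integral_ind_sub hs ⟨le_rfl, hs.1.trans hs.2⟩
  rw [sub_zero] at h
  have e : ∫ r, (if r ≤ s then (1 : ℝ) else 0) ∂S.μ
      = ∫ r, (if r ≤ s then 1 else 0) * ind (r - 0) ∂S.μ :=
    integral_congr_ae (S.ae_mem.mono fun r hr => by simp [ind, hr.1])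
  rw [e, h]
  simp [ind, hs.1]

theorem IsState.us_rep (h : S.IsState u us uss) {s : ℝ} (hs : s ∈ Icc 0 S.L) :
    col (us s) = col (us 0) + mI S.μ fun η => ind (s - η) • col (uss η) := by
  have h0 : (0 : ℝ) ∈ Icc 0 S.L := ⟨le_rfl, hs.1.trans hs.2⟩
  rw [h.us_eq s hs, col_add, col_intervalIntegral
    (intervalIntegrable (h.memLp.integrable one_le_two) h0 hs), S.mint_Iic_0 hs]
  simp only [ind, sub_nonneg]

theorem IsState.mInt_ind (h : S.IsState u us uss) :
    MInt (S.μ.prod S.μ) fun p : ℝ × ℝ => ind (p.1 - p.2) • col (uss p.2) :=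
  MInt.smul (memLp_ind (by fun_prop)) h.mInt.snd

theorem IsState.mInt_us (h : S.IsState u us uss) : MInt S.μ fun t => col (us t) :=
  ((MBdd.const _).mInt.add (MInt.integral h.mInt_ind)).congr
    (S.ae_mem.mono fun _ ht => (h.us_rep ht).symm)

/-- Taylor's formula with integral remainder: integrate the formula for x_s and exchange the order
of integration. -/
theorem IsState.u_rep (h : S.IsState u us uss) {s : ℝ} (hs : s ∈ Icc 0 S.L) :
    col (u s) = col (u 0) + s • col (us 0)
      + mI S.μ fun η => (ind (s - η) * (s - η)) • col (uss η) := by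
  have h0 : (0 : ℝ) ∈ Icc 0 S.L := ⟨le_rfl, hs.1.trans hs.2⟩
  have hi : MInt (S.μ.prod S.μ) fun p : ℝ × ℝ =>
      ((if p.1 ≤ s then 1 else 0) * ind (p.1 - p.2)) • col (uss p.2) :=
    MInt.smul (((memLp_ind (by fun_prop)).mul
      (memLp_ite (measurableSet_le measurable_fst measurable_const)))) h.mInt.snd
  have e : ∀ r ∈ Icc 0 S.L, (if r ≤ s then (1 : ℝ) else 0) • col (us r)
      = (if r ≤ s then (1 : ℝ) else 0) • col (us 0)
        + mI S.μ fun η => ((if r ≤ s then 1 else 0) * ind (r - η)) • col (uss η) := fun r hr => by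
    simp only [h.us_rep hr, smul_add, mul_smul, mI_smul]
  rw [h.u_eq s hs, col_add, col_intervalIntegral (intervalIntegrable h.mInt_us.integrable h0 hs),
    S.mint_Iic_0 hs, mI_congr (S.ae_mem.mono e),
    mI_add (MInt.smul (memLp_ite measurableSet_Iic) (MBdd.const _).mInt) (MInt.integral hi),
    mI_smul_const, integral_le_indicator hs, mI_swap hi, add_assoc]
  congr 2
  refine mI_congr (S.ae_mem.mono fun η hη => ?_)
  rw [mI_smul_const, integral_ind_sub hs hη]

variable (S) in
/-- The boundary values as a column. -/
def bdryCol (u us : ℝ → E n) : Matrix (Fin 4 × Fin n) Unit ℝ := Matrix.of fun p _ => S.bdry u us p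

/-- The initial values `[u(0); u_s(0)]` as a column. -/
def initCol (u us : ℝ → E n) : Matrix (Fin 2 × Fin n) Unit ℝ :=
  Matrix.of fun p j => ![col (u 0), col (us 0)] p.1 p.2 j

theorem IsState.mInt_bdry (h : S.IsState u us uss) :
    MInt S.μ fun η => colBlk n ![0, S.L - η, 0, 1] * col (uss η) :=
  ((Tame.of_continuous isCompact_Icc fun i j =>
    S.continuous_bdryCol.matrix_elem i j).mBdd S.ae_mem).mul_mInt h.mInt

theorem IsState.bdry_rep (hL : 0 < S.L) (h : S.IsState u us uss) :
    S.bdryCol u us = blk n !![1, 0; 1, S.L; 0, 1; 0, 1] * initCol u us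
      + mI S.μ fun η => colBlk n ![0, S.L - η, 0, 1] * col (uss η) := by
  have hs : S.L ∈ Icc 0 S.L := ⟨hL.le, le_rfl⟩
  have e1 := h.u_rep hs
  have e2 := h.us_rep hs
  have e3 : (mI S.μ fun η => (ind (S.L - η) * (S.L - η)) • col (uss η))
      = mI S.μ fun η => (S.L - η) • col (uss η) :=
    mI_congr (S.ae_mem.mono fun η hη => by simp [ind, hη.2])
  have e4 : (mI S.μ fun η => ind (S.L - η) • col (uss η)) = mI S.μ fun η => col (uss η) :=
    mI_congr (S.ae_mem.mono fun η hη => by simp [ind, hη.2])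
  rw [e3] at e1
  rw [e4] at e2
  ext ⟨i, k⟩ j
  have f1 := congrFun (congrFun e1 k) j
  have f2 := congrFun (congrFun e2 k) j
  simp only [Matrix.add_apply, blk_mul, mI, Matrix.of_apply, colBlk_mul, Fin.sum_univ_two]
  simp only [Matrix.add_apply, mI, Matrix.of_apply, Matrix.smul_apply, smul_eq_mul] at f1 f2
  fin_cases i
  · simp [bdryCol, bdry, initCol, col]
  · simpa [bdryCol, bdry, initCol, col] using f1
  · simp [bdryCol, bdry, initCol, col]
  · simpa [bdryCol, bdry, initCol, col] using f2

theorem mBdd_Bc : MBdd S.μ S.Bc :=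
  (Tame.of_continuous isCompact_Icc fun i j => S.continuous_Bc.matrix_elem i j).mBdd S.ae_mem

/-- Applying `B` to the boundary values gives `B2` times the initial values plus an integral of
x_ss, and the sum is zero; inverting `B2` gives the definition of `Bc`. -/
theorem IsState.init_rep (hL : 0 < S.L) (hB : IsUnit S.B2.det) (h : S.IsState u us uss) :
    initCol u us = mI S.μ fun η => S.Bc η * col (uss η) := by
  have hz : S.B * S.bdryCol u us = 0 := by
    ext i j
    exact congrFun h.bc i
  rw [h.bdry_rep hL, Matrix.mul_add, ← Matrix.mul_assoc] at hz
  have h2 : S.B2 * initCol u us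
      = -(S.B * mI S.μ fun η => colBlk n ![0, S.L - η, 0, 1] * col (uss η)) :=
    eq_neg_of_add_eq_zero_left hz
  have h3 : initCol u us = S.B2⁻¹ * (S.B2 * initCol u us) :=
    (Matrix.nonsing_inv_mul_cancel_left _ _ hB).symm
  have e : ∀ η, S.Bc η * col (uss η)
      = -(S.B2⁻¹ * S.B) * (colBlk n ![0, S.L - η, 0, 1] * col (uss η)) := fun η => by
    simp only [Bc, Matrix.neg_mul, Matrix.mul_assoc]
  simp only [e]
  rw [mI_const_mul _ h.mInt_bdry, h3, h2, Matrix.mul_neg, Matrix.neg_mul, Matrix.mul_assoc]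

theorem IsState.u_green (hL : 0 < S.L) (hB : IsUnit S.B2.det) (h : S.IsState u us uss) {s : ℝ}
    (hs : s ∈ Icc 0 S.L) : col (u s) = mI S.μ fun η => S.G s η * col (uss η) := by
  have e : ∀ η, S.G s η * col (uss η) = rowBlk n ![1, s] * (S.Bc η * col (uss η))
      + (ind (s - η) * (s - η)) • col (uss η) := fun η => by
    simp [G, Ba, Matrix.add_mul, Matrix.mul_assoc]
  have hc : MemLp (fun η => ind (s - η) * (s - η)) ⊤ S.μ :=
    (S.memLp_cont (f := fun η => s - η) (by fun_prop)).mul (memLp_ind (by fun_prop))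
  have hi := mBdd_Bc.mul_mInt h.mInt
  simp only [e]
  rw [mI_add (hi.const_mul _) (h.mInt.smul hc), mI_const_mul _ hi, ← h.init_rep hL hB, h.u_rep hs]
  congr 1
  ext i j
  simp [rowBlk_mul, initCol]

theorem IsState.us_green (hL : 0 < S.L) (hB : IsUnit S.B2.det) (h : S.IsState u us uss) {s : ℝ}
    (hs : s ∈ Icc 0 S.L) : col (us s) = mI S.μ fun η => S.Gs s η * col (uss η) := by
  have e : ∀ η, S.Gs s η * col (uss η) = rowBlk n ![0, 1] * (S.Bc η * col (uss η))
      + ind (s - η) • col (uss η) := fun η => by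
    simp [Gs, Bb, Matrix.add_mul, Matrix.mul_assoc]
  have hi := mBdd_Bc.mul_mInt h.mInt
  simp only [e]
  rw [mI_add (hi.const_mul _) (h.mInt.smul (memLp_ind (by fun_prop))), mI_const_mul _ hi,
    ← h.init_rep hL hB, h.us_rep hs]
  congr 1
  ext i j
  simp [rowBlk_mul, initCol]

theorem mBdd_G_right {s : ℝ} (hs : s ∈ Icc 0 S.L) : MBdd S.μ fun η => S.G s η :=
  (S.tame_G.right hs).mBdd S.ae_mem

theorem mBdd_Gs_right {s : ℝ} (hs : s ∈ Icc 0 S.L) : MBdd S.μ fun η => S.Gs s η :=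
  (S.tame_Gs.right hs).mBdd S.ae_mem

theorem mBdd_G_prod : MBdd (S.μ.prod S.μ) fun p => S.G p.1 p.2 := S.tame_G.mBdd S.ae_mem_prod

theorem mBdd_Gs_prod : MBdd (S.μ.prod S.μ) fun p => S.Gs p.1 p.2 := S.tame_Gs.mBdd S.ae_mem_prod

theorem IsState.mInt_u (hL : 0 < S.L) (hB : IsUnit S.B2.det) (h : S.IsState u us uss) :
    MInt S.μ fun t => col (u t) :=
  (MInt.integral (mBdd_G_prod.mul_mInt h.mInt.snd)).congr
    (S.ae_mem.mono fun _ ht => (h.u_green hL hB ht).symm)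

/-- Composition of a matrix function with an integral operator. -/
theorem mI_mul_mI {a b c : ℕ} {κ : Type*} {A : ℝ → Mat a b} (hA : MBdd S.μ A) {g : ℝ → ℝ → Mat b c}
    (hg : MBdd (S.μ.prod S.μ) fun p => g p.1 p.2) (hg' : ∀ s ∈ Icc 0 S.L, MBdd S.μ (g s))
    (hg'' : ∀ η ∈ Icc 0 S.L, MBdd S.μ fun s => g s η)
    {V : ℝ → Matrix (Fin c) κ ℝ} (hV : MInt S.μ V) :
    (mI S.μ fun s => A s * mI S.μ fun η => g s η * V η)
      = mI S.μ fun η => (mI S.μ fun s => A s * g s η) * V η := by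
  have hi : MInt (S.μ.prod S.μ) fun p : ℝ × ℝ => A p.1 * g p.1 p.2 * V p.2 :=
    (hA.fst.mul hg).mul_mInt hV.snd
  have e1 : ∀ s ∈ Icc 0 S.L, (A s * mI S.μ fun η => g s η * V η)
      = mI S.μ fun η => A s * g s η * V η := fun s hs => by
    rw [← mI_const_mul _ ((hg' s hs).mul_mInt hV)]
    simp only [Matrix.mul_assoc]
  have e2 : ∀ η ∈ Icc 0 S.L, (mI S.μ fun s => A s * g s η) * V η
      = mI S.μ fun s => A s * g s η * V η := fun η hη => by
    rw [mI_mul_const (hA.mul (hg'' η hη)).mInt]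
  rw [mI_congr (S.ae_mem.mono e1), mI_congr (S.ae_mem.mono e2), mI_swap hi]

theorem mBdd_G_left {θ : ℝ} (hθ : θ ∈ Icc 0 S.L) : MBdd S.μ fun s => S.G s θ :=
  (S.tame_G.left hθ).mBdd S.ae_mem

theorem mBdd_Gs_left {θ : ℝ} (hθ : θ ∈ Icc 0 S.L) : MBdd S.μ fun s => S.Gs s θ :=
  (S.tame_Gs.left hθ).mBdd S.ae_mem

theorem mBdd_C3 (hL : 0 < S.L) (hCa : MBdd S.μ S.Ca) (hCb : MBdd S.μ S.Cb) : MBdd S.μ S.C3 := by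
  have h1 : MBdd S.μ fun θ => colBlk n ![0, S.L - θ, 0, 1] :=
    (Tame.of_continuous isCompact_Icc fun i j =>
      S.continuous_bdryCol.matrix_elem i j).mBdd S.ae_mem
  have h2 : MBdd S.μ fun θ => mI S.μ fun s => S.Ca s * S.G s θ + S.Cb s * S.Gs s θ :=
    MBdd.integral (F := fun θ s => S.Ca s * S.G s θ + S.Cb s * S.Gs s θ)
      ((hCa.snd.mul mBdd_G_prod.swap).add (hCb.snd.mul mBdd_Gs_prod.swap))
  have h3 := (((MBdd.const (ν := S.μ) S.C1).mul (((MBdd.const (blk n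
    !![1, 0; 1, S.L; 0, 1; 0, 1])).mul mBdd_Bc).add h1)).add h2)
  simp only [← S.mint_eq_mI hL.le] at h3
  exact h3

/-- All three contributions to the output other than that of w are linear in x_ss: the boundary
values through `bdry_rep` and `init_rep`, the two integral terms through the Green's functions and
Fubini. -/
theorem IsState.output_rep (hL : 0 < S.L) (hB : IsUnit S.B2.det) (hCa : MBdd S.μ S.Ca)
    (hCb : MBdd S.μ S.Cb) (h : S.IsState u us uss) (w : E m) :
    col (S.output u us w) = (mI S.μ fun η => S.C3 η * col (uss η)) + S.D1 * col w := by
  have hV := h.mInt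
  have ha := hCa.mul_mInt (h.mInt_u hL hB)
  have hb := hCb.mul_mInt h.mInt_us
  have hint : Integrable (fun s => act (S.Ca s) (u s) + act (S.Cb s) (us s)) S.μ :=
    MInt.integrable (ha.add hb)
  have hBc := mBdd_Bc.mul_mInt hV
  have hG : ∀ η ∈ Icc 0 S.L, MBdd S.μ fun s => S.Ca s * S.G s η := fun η hη =>
    hCa.mul (mBdd_G_left hη)
  have hGs : ∀ η ∈ Icc 0 S.L, MBdd S.μ fun s => S.Cb s * S.Gs s η := fun η hη =>
    hCb.mul (mBdd_Gs_left hη)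
  have e : ∀ η ∈ Icc 0 S.L, S.C3 η * col (uss η)
      = S.C1 * (blk n !![1, 0; 1, S.L; 0, 1; 0, 1] * (S.Bc η * col (uss η))
          + colBlk n ![0, S.L - η, 0, 1] * col (uss η))
        + ((mI S.μ fun s => S.Ca s * S.G s η) * col (uss η)
          + (mI S.μ fun s => S.Cb s * S.Gs s η) * col (uss η)) := fun η hη => by
    rw [C3, S.mint_eq_mI hL.le, mI_add (hG η hη).mInt (hGs η hη).mInt]
    simp only [Matrix.add_mul, Matrix.mul_assoc, Matrix.mul_add]
  have hCG : MBdd S.μ fun η => mI S.μ fun s => S.Ca s * S.G s η :=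
    MBdd.integral (F := fun η s => S.Ca s * S.G s η) (hCa.snd.mul mBdd_G_prod.swap)
  have hCGs : MBdd S.μ fun η => mI S.μ fun s => S.Cb s * S.Gs s η :=
    MBdd.integral (F := fun η s => S.Cb s * S.Gs s η) (hCb.snd.mul mBdd_Gs_prod.swap)
  have eu : (mI S.μ fun s => S.Ca s * col (u s))
      = mI S.μ fun η => (mI S.μ fun s => S.Ca s * S.G s η) * col (uss η) := by
    rw [← mI_mul_mI hCa mBdd_G_prod (fun _ => mBdd_G_right) (fun _ => mBdd_G_left) hV]
    exact mI_congr (S.ae_mem.mono fun s hs => by rw [h.u_green hL hB hs])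
  have eus : (mI S.μ fun s => S.Cb s * col (us s))
      = mI S.μ fun η => (mI S.μ fun s => S.Cb s * S.Gs s η) * col (uss η) := by
    rw [← mI_mul_mI hCb mBdd_Gs_prod (fun _ => mBdd_Gs_right) (fun _ => mBdd_Gs_left) hV]
    exact mI_congr (S.ae_mem.mono fun s hs => by rw [h.us_green hL hB hs])
  have ei : col (∫ s in (0 : ℝ)..S.L, (act (S.Ca s) (u s) + act (S.Cb s) (us s)))
      = (mI S.μ fun s => S.Ca s * col (u s)) + mI S.μ fun s => S.Cb s * col (us s) := by
    rw [intervalIntegral.integral_of_le hL.le, ← integral_Icc_eq_integral_Ioc, col_integral hint,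
      ← mI_add ha hb]
    rfl
  have ez : col (WithLp.toLp 2 (S.C1 *ᵥ S.bdry u us)) = S.C1 * S.bdryCol u us := rfl
  rw [output, col_add, col_add, col_act, ez, ei, eu, eus, mI_congr (S.ae_mem.mono e),
    mI_add (((hBc.const_mul _).add h.mInt_bdry).const_mul _)
      ((hCG.mul_mInt hV).add (hCGs.mul_mInt hV)), mI_add (hCG.mul_mInt hV) (hCGs.mul_mInt hV),
    mI_const_mul _ ((hBc.const_mul _).add h.mInt_bdry), mI_add (hBc.const_mul _) h.mInt_bdry,
    mI_const_mul _ hBc, ← h.init_rep hL hB, ← h.bdry_rep hL]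

end System
end PDEGain

/-! ### The kernels of ⟨x, 𝒫 ẋ⟩ and their identification with `H` and `Q` -/

namespace PDEGain
namespace System

variable {n m q : ℕ} {S : System n m q} {K : Kernel n} {u us uss : ℝ → E n}

theorem _root_.PDEGain.Kernel.Cont.regular (hK : K.Cont) : S.RegularKernel K := by
  have h : K.mulRight (fun _ => 1) = K := by simp [Kernel.mulRight]
  exact h ▸ hK.mulRight (MBdd.const 1)

theorem col_opP (hK : S.RegularKernel K) {f : ℝ → E n} (hf : MInt S.μ fun t => col (f t)) {s : ℝ}
    (hs : s ∈ Icc 0 S.L) : col (S.opP K f s) = S.Y K (fun t => col (f t)) s := by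
  have h0 : (0 : ℝ) ∈ Icc 0 S.L := ⟨le_rfl, hs.1.trans hs.2⟩
  have hL : S.L ∈ Icc 0 S.L := ⟨hs.1.trans hs.2, le_rfl⟩
  have h1 : Integrable (fun θ => act (K.N1 s θ) (f θ)) S.μ :=
    MInt.integrable ((hK.N1_right s hs).mul_mInt hf)
  have h2 : Integrable (fun θ => act (K.N2 s θ) (f θ)) S.μ :=
    MInt.integrable ((hK.N2_right s hs).mul_mInt hf)
  rw [opP, col_add, col_add, col_act, col_intervalIntegral (intervalIntegrable h1 h0 hs),
    col_intervalIntegral (intervalIntegrable h2 hs hL)]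
  rfl

theorem tame_N (hK : K.Cont) : Tame (Icc 0 S.L ×ˢ Icc 0 S.L) fun p : ℝ × ℝ => K.N p.1 p.2 :=
  Tame.ite (measurableSet_lt measurable_snd measurable_fst)
    (Tame.of_continuous (isCompact_Icc.prod isCompact_Icc) hK.N1)
    (Tame.of_continuous (isCompact_Icc.prod isCompact_Icc) hK.N2)

theorem tame_T (hK : K.Cont) : Tame (Icc 0 S.L ×ˢ Icc 0 S.L) fun p => S.T K p.1 p.2 := by
  have hG : Tame (Icc 0 S.L ×ˢ Icc 0 S.L) fun p : ℝ × ℝ => (S.G p.2 p.1)ᵀ :=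
    (S.tame_G.comp (g := Prod.swap) (by fun_prop) fun p hp => ⟨hp.2, hp.1⟩).transpose
  have hM : Tame (Icc 0 S.L ×ˢ Icc 0 S.L) fun p : ℝ × ℝ => K.M p.2 :=
    (Tame.of_continuous isCompact_Icc hK.M).comp measurable_snd fun p hp => hp.2
  have hG' : Tame ((Icc 0 S.L ×ˢ Icc 0 S.L) ×ˢ Icc 0 S.L)
      fun p : (ℝ × ℝ) × ℝ => (S.G p.2 p.1.1)ᵀ :=
    (S.tame_G.comp (g := fun p : (ℝ × ℝ) × ℝ => (p.2, p.1.1)) (by fun_prop)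
      fun p hp => ⟨hp.2, hp.1.1⟩).transpose
  have hN' : Tame ((Icc 0 S.L ×ˢ Icc 0 S.L) ×ˢ Icc 0 S.L)
      fun p : (ℝ × ℝ) × ℝ => K.N p.2 p.1.2 :=
    (tame_N hK).comp (g := fun p : (ℝ × ℝ) × ℝ => (p.2, p.1.2)) (by fun_prop)
      fun p hp => ⟨hp.2, hp.1.2⟩
  exact (hG.mul hM).add (Tame.integral (F := fun (p : ℝ × ℝ) β => (S.G β p.1)ᵀ * K.N β p.2)
    S.ae_mem (hG'.mul hN'))

variable (S) in
/-- The kernel of `⟨x, 𝒫 (A₀ x + A₁ x_s + A₂ x_ss)⟩` in terms of `x_ss`. -/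
def R (K : Kernel n) (s θ : ℝ) : Mat n n :=
  S.T K s θ * S.A2 θ + (mI S.μ fun ζ => S.T K s ζ * S.A1 ζ * S.Gs ζ θ)
    + mI S.μ fun ζ => S.T K s ζ * S.A0 ζ * S.G ζ θ

theorem mBdd_T_prod (hK : K.Cont) : MBdd (S.μ.prod S.μ) fun p => S.T K p.1 p.2 :=
  (tame_T hK).mBdd S.ae_mem_prod

/-- `T` and `g` have bounds everywhere and can be pulled back to the triple product; `A` depends on
one coordinate only, so its essential bound pulls back too. -/
theorem mBdd_comp_T (hK : K.Cont) {A : ℝ → Mat n n} (hA : MBdd S.μ A) {g : ℝ → ℝ → Mat n n}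
    (hg : Tame (Icc 0 S.L ×ˢ Icc 0 S.L) fun p => g p.1 p.2) :
    MBdd (S.μ.prod S.μ) fun p => mI S.μ fun ζ => S.T K p.1 ζ * A ζ * g ζ p.2 := by
  have hν : ∀ᵐ p ∂((S.μ.prod S.μ).prod S.μ), p ∈ (Icc 0 S.L ×ˢ Icc 0 S.L) ×ˢ Icc 0 S.L := by
    rw [Measure.prod_restrict, Measure.prod_restrict]
    exact ae_restrict_mem ((measurableSet_Icc.prod measurableSet_Icc).prod measurableSet_Icc)
  have h1 : Tame ((Icc 0 S.L ×ˢ Icc 0 S.L) ×ˢ Icc 0 S.L)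
      fun p : (ℝ × ℝ) × ℝ => S.T K p.1.1 p.2 :=
    (tame_T hK).comp (g := fun p : (ℝ × ℝ) × ℝ => (p.1.1, p.2)) (by fun_prop)
      fun p hp => ⟨hp.1.1, hp.2⟩
  have h2 : Tame ((Icc 0 S.L ×ˢ Icc 0 S.L) ×ˢ Icc 0 S.L)
      fun p : (ℝ × ℝ) × ℝ => g p.2 p.1.2 :=
    hg.comp (g := fun p : (ℝ × ℝ) × ℝ => (p.2, p.1.2)) (by fun_prop)
      fun p hp => ⟨hp.2, hp.1.2⟩
  exact MBdd.integral (F := fun (p : ℝ × ℝ) ζ => S.T K p.1 ζ * A ζ * g ζ p.2)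
    (((h1.mBdd hν).mul hA.snd).mul (h2.mBdd hν))

theorem mBdd_R (hK : K.Cont) (hA0 : MBdd S.μ S.A0) (hA1 : MBdd S.μ S.A1) (hA2 : MBdd S.μ S.A2) :
    MBdd (S.μ.prod S.μ) fun p => S.R K p.1 p.2 :=
  (((mBdd_T_prod hK).mul hA2.snd).add (mBdd_comp_T hK hA1 S.tame_Gs)).add
    (mBdd_comp_T hK hA0 S.tame_G)

/-- Multiplying the argument of 𝒫 by `A` commutes with forming the kernel; this turns the products
V_i and W_ij in the data into the coefficients of the equation. -/
theorem T_mulRight (hK : K.Cont) (A : ℝ → Mat n n) {s θ : ℝ} (hs : s ∈ Icc 0 S.L)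
    (hθ : θ ∈ Icc 0 S.L) : S.T (K.mulRight A) s θ = S.T K s θ * A θ := by
  have hK' : S.RegularKernel K := hK.regular
  rw [T, T, Matrix.add_mul, ← mI_mul_const ((mBdd_G hs).mul (hK'.N_left hθ)).mInt]
  congr 1
  · exact (Matrix.mul_assoc _ _ _).symm
  · congr 1
    funext β
    rw [Matrix.mul_assoc]
    unfold Kernel.N
    split_ifs <;> rfl

theorem R_eq (hK : K.Cont) {s θ : ℝ} (hs : s ∈ Icc 0 S.L) (hθ : θ ∈ Icc 0 S.L) :
    S.R K s θ = S.T (K.mulRight S.A2) s θ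
      + (mI S.μ fun ζ => S.T (K.mulRight S.A1) s ζ * S.Gs ζ θ)
      + mI S.μ fun ζ => S.T (K.mulRight S.A0) s ζ * S.G ζ θ := by
  rw [R, T_mulRight hK _ hs hθ]
  congr 1
  · congr 1
    exact mI_congr (S.ae_mem.mono fun ζ hζ => by rw [T_mulRight hK _ hs hζ])
  · exact mI_congr (S.ae_mem.mono fun ζ hζ => by rw [T_mulRight hK _ hs hζ])

theorem H_fst_eq (hK : K.Cont) (hA0 : MBdd S.μ S.A0) (hA1 : MBdd S.μ S.A1) (hA2 : MBdd S.μ S.A2)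
    {s θ : ℝ} (hs : s ∈ Icc 0 S.L) (hθ : θ ∈ Icc 0 S.L) (h : θ < s) :
    (S.H K).1 s θ = S.R K s θ := by
  rw [R_eq hK hs hθ, ← L1_fst_eq (hK.mulRight hA2) hs hθ h,
    ← L2_fst_eq (hK.mulRight hA1) hs hθ h, ← L3_fst_eq (hK.mulRight hA0) hs hθ h]
  rfl

theorem H_snd_eq (hK : K.Cont) (hA0 : MBdd S.μ S.A0) (hA1 : MBdd S.μ S.A1) (hA2 : MBdd S.μ S.A2)
    {s θ : ℝ} (hs : s ∈ Icc 0 S.L) (hθ : θ ∈ Icc 0 S.L) (h : s < θ) :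
    (S.H K).2 s θ = S.R K s θ := by
  rw [R_eq hK hs hθ, ← L1_snd_eq (hK.mulRight hA2) hs hθ h,
    ← L2_snd_eq (hK.mulRight hA1) hs hθ h, ← L3_snd_eq (hK.mulRight hA0) hs hθ h]
  rfl

theorem V_eq (hK : K.Cont) {s θ : ℝ} (hs : s ∈ Icc 0 S.L) (hθ : θ ∈ Icc 0 S.L) :
    S.V K s θ = S.T K s θ * S.B1 θ := by
  have hK' : S.RegularKernel K := hK.regular
  rw [V, T, add_assoc, S.mint_add_mint_of_lt hθ ((mBdd_G hs).mul (hK'.N1_left θ hθ)).mInt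
    ((mBdd_G hs).mul (hK'.N2_left θ hθ)).mInt]
  congr 3
  funext β
  unfold Kernel.N
  split_ifs <;> rfl

variable (S) in
/-- The function with `⟨x, 𝒫 (B₁ w)⟩ = ∫ x_ss(s)ᵀ VB(s) w`. -/
def VB (K : Kernel n) (s : ℝ) : Mat n m := mI S.μ fun θ => S.T K s θ * S.B1 θ

theorem mBdd_VB (hK : K.Cont) (hB1 : MBdd S.μ S.B1) : MBdd S.μ (S.VB K) :=
  MBdd.integral (F := fun s θ => S.T K s θ * S.B1 θ) ((mBdd_T_prod hK).mul hB1.snd)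

theorem Q_eq (hL : 0 < S.L) (hK : K.Cont) {s : ℝ} (hs : s ∈ Icc 0 S.L) :
    S.Q K s = S.D1ᵀ * S.C3 s + (S.VB K s)ᵀ := by
  rw [Q, S.mint_eq_mI hL.le, VB, ← mI_transpose]
  congr 1
  exact mI_congr (S.ae_mem.mono fun θ hθ => by rw [V_eq hK hs hθ])

theorem IsState.mInt_rhs (hL : 0 < S.L) (hB : IsUnit S.B2.det) (hA0 : MBdd S.μ S.A0)
    (hA1 : MBdd S.μ S.A1) (hA2 : MBdd S.μ S.A2) (hB1 : MBdd S.μ S.B1) (h : S.IsState u us uss)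
    (w : E m) : MInt S.μ fun t => col (S.rhs u us uss w t) :=
  (((hA0.mul_mInt (h.mInt_u hL hB)).add (hA1.mul_mInt h.mInt_us)).add (hA2.mul_mInt h.mInt)).add
    (hB1.mul_mInt (MBdd.const (col w)).mInt)

theorem IsState.mI_T_rhs (hL : 0 < S.L) (hB : IsUnit S.B2.det) (hK : K.Cont) (hA0 : MBdd S.μ S.A0)
    (hA1 : MBdd S.μ S.A1) (hA2 : MBdd S.μ S.A2) (hB1 : MBdd S.μ S.B1) (h : S.IsState u us uss)
    (w : E m) {s : ℝ} :
    (mI S.μ fun θ => S.T K s θ * col (S.rhs u us uss w θ))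
      = (mI S.μ fun θ => S.R K s θ * col (uss θ)) + S.VB K s * col w := by
  have hK' : S.RegularKernel K := hK.regular
  have hT := mBdd_T_right hK' s
  have hV := h.mInt
  have hu := h.mInt_u hL hB
  have i0 := (hT.mul hA0).mul_mInt hu
  have i1 := (hT.mul hA1).mul_mInt h.mInt_us
  have i2 := (hT.mul hA2).mul_mInt hV
  have ib := (hT.mul hB1).mInt.mul_const (col w)
  have e : ∀ θ, S.T K s θ * col (S.rhs u us uss w θ) = S.T K s θ * S.A0 θ * col (u θ)
      + S.T K s θ * S.A1 θ * col (us θ) + S.T K s θ * S.A2 θ * col (uss θ)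
      + S.T K s θ * S.B1 θ * col w := fun θ => by
    simp only [rhs, col_add, col_act, Matrix.mul_add, Matrix.mul_assoc]
  have j0 : MBdd S.μ fun θ => mI S.μ fun ζ => S.T K s ζ * S.A0 ζ * S.G ζ θ :=
    MBdd.integral (F := fun θ ζ => S.T K s ζ * S.A0 ζ * S.G ζ θ)
      ((hT.mul hA0).snd.mul mBdd_G_prod.swap)
  have j1 : MBdd S.μ fun θ => mI S.μ fun ζ => S.T K s ζ * S.A1 ζ * S.Gs ζ θ :=
    MBdd.integral (F := fun θ ζ => S.T K s ζ * S.A1 ζ * S.Gs ζ θ)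
      ((hT.mul hA1).snd.mul mBdd_Gs_prod.swap)
  have e0 : (mI S.μ fun θ => S.T K s θ * S.A0 θ * col (u θ))
      = mI S.μ fun θ => (mI S.μ fun ζ => S.T K s ζ * S.A0 ζ * S.G ζ θ) * col (uss θ) := by
    rw [← mI_mul_mI (hT.mul hA0) mBdd_G_prod (fun _ => mBdd_G_right) (fun _ => mBdd_G_left) hV]
    exact mI_congr (S.ae_mem.mono fun θ hθ => by rw [h.u_green hL hB hθ])
  have e1 : (mI S.μ fun θ => S.T K s θ * S.A1 θ * col (us θ))
      = mI S.μ fun θ => (mI S.μ fun ζ => S.T K s ζ * S.A1 ζ * S.Gs ζ θ) * col (uss θ) := by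
    rw [← mI_mul_mI (hT.mul hA1) mBdd_Gs_prod (fun _ => mBdd_Gs_right) (fun _ => mBdd_Gs_left) hV]
    exact mI_congr (S.ae_mem.mono fun θ hθ => by rw [h.us_green hL hB hθ])
  simp only [e, R, Matrix.add_mul]
  rw [mI_add ((i0.add i1).add i2) ib, mI_add (i0.add i1) i2, mI_add i0 i1,
    mI_mul_const (hT.mul hB1).mInt, e0, e1, mI_add (i2.add (j1.mul_mInt hV)) (j0.mul_mInt hV),
    mI_add i2 (j1.mul_mInt hV), VB]
  abel

/-- `⟨x, 𝒫 f⟩ = ∫∫ x_ss(s)ᵀ T(s,θ) f(θ)`. -/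
theorem IsState.mI_u_Y (hL : 0 < S.L) (hB : IsUnit S.B2.det) (hK : S.RegularKernel K)
    (h : S.IsState u us uss) {f : ℝ → Matrix (Fin n) Unit ℝ} (hf : MInt S.μ f) :
    (mI S.μ fun ζ => (col (u ζ))ᵀ * S.Y K f ζ)
      = mI S.μ fun s => (col (uss s))ᵀ * mI S.μ fun θ => S.T K s θ * f θ := by
  have hV := h.mInt
  have hY := mInt_Y hK hf
  have hi : MInt (S.μ.prod S.μ) fun p : ℝ × ℝ => (col (uss p.1))ᵀ * (S.G p.2 p.1)ᵀ * S.Y K f p.2 :=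
    hV.transpose.mul_mBdd_mul_prod (mBdd_G_prod.swap).transpose hY
  have e1 : ∀ ζ ∈ Icc 0 S.L, (col (u ζ))ᵀ * S.Y K f ζ
      = mI S.μ fun s => (col (uss s))ᵀ * (S.G ζ s)ᵀ * S.Y K f ζ := fun ζ hζ => by
    have hi := (mBdd_G_right hζ).mul_mInt hV
    rw [h.u_green hL hB hζ, ← mI_transpose, ← mI_mul_const hi.transpose]
    simp only [Matrix.transpose_mul]
  have e2 : ∀ s ∈ Icc 0 S.L, ((col (uss s))ᵀ * mI S.μ fun θ => S.T K s θ * f θ)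
      = mI S.μ fun ζ => (col (uss s))ᵀ * (S.G ζ s)ᵀ * S.Y K f ζ := fun s hs => by
    rw [mI_T_mul hK hf hs, ← mI_const_mul _ ((mBdd_G hs).mul_mInt hY)]
    simp only [Matrix.mul_assoc]
  rw [mI_congr (S.ae_mem.mono e1), mI_congr (S.ae_mem.mono e2)]
  exact (mI_swap hi).symm

end System
end PDEGain

/-! ### The energy identity -/

namespace PDEGain

theorem MInt.section_ae {α β ι κ : Type*} [MeasurableSpace α] [MeasurableSpace β] {ν : Measure α}
    {ν' : Measure β} [SFinite ν] [SFinite ν'] [Countable ι] [Countable κ]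
    {F : α → β → Matrix ι κ ℝ} (hF : MInt (ν.prod ν') fun p => F p.1 p.2) :
    ∀ᵐ a ∂ν, MInt ν' (F a) := by
  simp only [MInt, ae_all_iff]
  exact fun i j => (hF i j).prod_right_ae

namespace System

variable {n m q : ℕ} {S : System n m q} {K : Kernel n} {u us uss : ℝ → E n}

theorem intervalIntegral_eq (hL : 0 < S.L) (f : ℝ → ℝ) :
    ∫ s in (0 : ℝ)..S.L, f s = ∫ s, f s ∂S.μ := by
  rw [intervalIntegral.integral_of_le hL.le, integral_Icc_eq_integral_Ioc]

variable (S) in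
/-- The symmetric kernel of the quadratic form in `x_ss`. -/
def Rsymm (K : Kernel n) (s θ : ℝ) : Mat n n :=
  S.R K s θ + (S.R K θ s)ᵀ + (S.C3 s)ᵀ * S.C3 θ

/-- For θ < s both terms are evaluated where they are known: `H₁` at (s, θ) below the diagonal, and
`H₂` at (θ, s) above it. -/
theorem R1_eq (hK : K.Cont) (hA0 : MBdd S.μ S.A0) (hA1 : MBdd S.μ S.A1) (hA2 : MBdd S.μ S.A2)
    {s θ : ℝ} (hs : s ∈ Icc 0 S.L) (hθ : θ ∈ Icc 0 S.L) (h : θ < s) :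
    S.R1 K s θ = S.Rsymm K s θ := by
  rw [R1, Rsymm, H_fst_eq hK hA0 hA1 hA2 hs hθ h, H_snd_eq hK hA0 hA1 hA2 hθ hs h]

theorem R2_eq (hK : K.Cont) (hA0 : MBdd S.μ S.A0) (hA1 : MBdd S.μ S.A1) (hA2 : MBdd S.μ S.A2)
    {s θ : ℝ} (hs : s ∈ Icc 0 S.L) (hθ : θ ∈ Icc 0 S.L) (h : s < θ) :
    S.R2 K s θ = S.Rsymm K s θ := by
  rw [R2, R1_eq hK hA0 hA1 hA2 hθ hs h, Rsymm, Rsymm]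
  simp only [Matrix.transpose_add, Matrix.transpose_transpose, Matrix.transpose_mul]
  abel

theorem col_opR (hL : 0 < S.L) (hK : K.Cont) (hA0 : MBdd S.μ S.A0) (hA1 : MBdd S.μ S.A1)
    (hA2 : MBdd S.μ S.A2) {f : ℝ → E n} {s : ℝ} (hs : s ∈ Icc 0 S.L)
    (hf : MInt S.μ fun θ => S.Rsymm K s θ * col (f θ)) :
    col ((∫ θ in (0 : ℝ)..s, act (S.R1 K s θ) (f θ)) + ∫ θ in s..S.L, act (S.R2 K s θ) (f θ))
      = mI S.μ fun θ => S.Rsymm K s θ * col (f θ) := by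
  have h0 : (0 : ℝ) ∈ Icc 0 S.L := ⟨le_rfl, hL.le⟩
  have h1 : S.L ∈ Icc 0 S.L := ⟨hL.le, le_rfl⟩
  have hne : ∀ᵐ θ ∂(volume : Measure ℝ), θ ≠ s := Measure.ae_ne volume s
  have e1 : ∫ θ in (0 : ℝ)..s, act (S.R1 K s θ) (f θ)
      = ∫ θ in (0 : ℝ)..s, act (S.Rsymm K s θ) (f θ) := by
    refine intervalIntegral.integral_congr_ae (hne.mono fun θ hθ hm => ?_)
    rw [uIoc_of_le hs.1] at hm
    rw [R1_eq hK hA0 hA1 hA2 hs ⟨hm.1.le, hm.2.trans hs.2⟩ (lt_of_le_of_ne hm.2 hθ)]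
  have e2 : ∫ θ in s..S.L, act (S.R2 K s θ) (f θ)
      = ∫ θ in s..S.L, act (S.Rsymm K s θ) (f θ) := by
    refine intervalIntegral.integral_congr_ae (Filter.Eventually.of_forall fun θ hm => ?_)
    rw [uIoc_of_le hs.2] at hm
    rw [R2_eq hK hA0 hA1 hA2 hs ⟨hs.1.trans hm.1.le, hm.2⟩ hm.1]
  have hi : Integrable (fun θ => act (S.Rsymm K s θ) (f θ)) S.μ := MInt.integrable hf
  rw [e1, e2, col_add, col_intervalIntegral (intervalIntegrable hi h0 hs),
    col_intervalIntegral (intervalIntegrable hi hs h1)]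
  simp only [col_act]
  rw [S.mint_add_mint_of_gt hs hf hf]
  simp only [ite_self]

theorem mBdd_Q (hL : 0 < S.L) (hK : K.Cont) (hB1 : MBdd S.μ S.B1) (hCa : MBdd S.μ S.Ca)
    (hCb : MBdd S.μ S.Cb) : MBdd S.μ (S.Q K) :=
  (((MBdd.const _).mul (mBdd_C3 hL hCa hCb)).add (mBdd_VB hK hB1).transpose).congr
    (S.ae_mem.mono fun _ hs => (Q_eq hL hK hs).symm)

/-- The quadratic form of `𝒫_{P,Q,R₁,R₂}` at `(w, x_ss)` is the derivative of the storage function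
plus the supply `‖y‖² - γ² ‖w‖²`. -/
theorem IsState.energy (hL : 0 < S.L) (hB : IsUnit S.B2.det) (hK : K.Cont) (hA0 : MBdd S.μ S.A0)
    (hA1 : MBdd S.μ S.A1) (hA2 : MBdd S.μ S.A2) (hB1 : MBdd S.μ S.B1) (hCa : MBdd S.μ S.Ca)
    (hCb : MBdd S.μ S.Cb) (h : S.IsState u us uss) (w : E m) (γ : ℝ) :
    ∫ s in (0 : ℝ)..S.L,
      (inner ℝ w (S.opPQRS (S.P γ) (S.Q K) (S.R1 K) (S.R2 K) w uss).1
        + inner ℝ (uss s) ((S.opPQRS (S.P γ) (S.Q K) (S.R1 K) (S.R2 K) w uss).2 s))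
    = 2 * (∫ s in (0 : ℝ)..S.L, inner ℝ (u s) (S.opP K (S.rhs u us uss w) s))
      + ‖S.output u us w‖ ^ 2 - γ ^ 2 * ‖w‖ ^ 2 := by
  have hK' : S.RegularKernel K := hK.regular
  have hV := h.mInt
  have hR := mBdd_R hK hA0 hA1 hA2
  have hC := mBdd_C3 hL hCa hCb
  have hVB := mBdd_VB hK hB1
  have hQ := mBdd_Q hL hK hB1 hCa hCb
  have hrhs := h.mInt_rhs hL hB hA0 hA1 hA2 hB1 w
  set W := col w
  set V : ℝ → Matrix (Fin n) Unit ℝ := fun s => col (uss s)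
  set c := mI S.μ fun s => S.C3 s * V s with hc
  set e := mI S.μ fun s => (S.VB K s)ᵀ * V s with he
  set J := mI S.μ fun s => mI S.μ fun θ => (V s)ᵀ * S.R K s θ * V θ with hJ
  have iJ : MInt (S.μ.prod S.μ) fun p : ℝ × ℝ => (V p.1)ᵀ * S.R K p.1 p.2 * V p.2 :=
    hV.transpose.mul_mBdd_mul_prod hR hV
  have iJ' : MInt (S.μ.prod S.μ) fun p : ℝ × ℝ => (V p.1)ᵀ * (S.R K p.2 p.1)ᵀ * V p.2 :=
    hV.transpose.mul_mBdd_mul_prod hR.swap.transpose hV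
  have iV : MInt S.μ fun s => (V s)ᵀ * (S.VB K s * W) := by
    have := (hV.transpose.mul_mBdd hVB).mul_const W
    simpa only [Matrix.mul_assoc] using this
  -- `R` is controlled only almost everywhere on the square, so these sections are integrable for
  -- almost every s, which suffices under the outer integral.
  have sec1 := (hR.mul_mInt hV.snd).section_ae
    (F := fun s θ => S.R K s θ * V θ)
  have sec2 := (hR.swap.transpose.mul_mInt hV.snd).section_ae
    (F := fun s θ => (S.R K θ s)ᵀ * V θ)
  have iCV : MInt S.μ fun s => S.C3 s * V s := hC.mul_mInt hV
  -- the derivative of the storage function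
  have stor : ∫ s in (0 : ℝ)..S.L, inner ℝ (u s) (S.opP K (S.rhs u us uss w) s)
      = (J + eᵀ * W) () () := by
    have e1 : ∫ s in (0 : ℝ)..S.L, inner ℝ (u s) (S.opP K (S.rhs u us uss w) s)
        = (mI S.μ fun s => (col (u s))ᵀ * S.Y K (fun t => col (S.rhs u us uss w t)) s) () () := by
      rw [intervalIntegral_eq hL]
      refine integral_congr_ae (S.ae_mem.mono fun s hs => ?_)
      simp only [inner_eq_col, col_opP hK' hrhs hs]
    rw [e1, h.mI_u_Y hL hB hK' hrhs]
    simp only [h.mI_T_rhs hL hB hK hA0 hA1 hA2 hB1]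
    have e2 : (mI S.μ fun s => (V s)ᵀ * ((mI S.μ fun θ => S.R K s θ * V θ) + S.VB K s * W))
        = mI S.μ fun s => (mI S.μ fun θ => (V s)ᵀ * S.R K s θ * V θ) + (V s)ᵀ * (S.VB K s * W) :=
      mI_congr (sec1.mono fun s hs => by
        rw [Matrix.mul_add, ← mI_const_mul _ hs]
        simp only [Matrix.mul_assoc])
    have e3 : (mI S.μ fun s => (V s)ᵀ * (S.VB K s * W)) = eᵀ * W := by
      rw [he, ← mI_transpose, ← mI_mul_const (hVB.transpose.mul_mInt hV).transpose]
      simp only [Matrix.transpose_mul, Matrix.transpose_transpose, Matrix.mul_assoc]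
    rw [e2, mI_add (MInt.integral iJ) iV, e3]
  have out : ‖S.output u us w‖ ^ 2 = ((c + S.D1 * W)ᵀ * (c + S.D1 * W)) () () := by
    rw [← real_inner_self_eq_norm_sq, inner_eq_col, h.output_rep hL hB hCa hCb w]
  have win : ‖w‖ ^ 2 = (Wᵀ * W) () () := by
    rw [← real_inner_self_eq_norm_sq, inner_eq_col]
  -- the quadratic form
  have hq : (mI S.μ fun s => S.Q K s * V s) = S.D1ᵀ * c + e := by
    rw [hc, he, ← mI_const_mul _ iCV, ← mI_add (iCV.const_mul _) (hVB.transpose.mul_mInt hV)]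
    exact mI_congr (S.ae_mem.mono fun s hs => by
      rw [Q_eq hL hK hs, Matrix.add_mul, Matrix.mul_assoc])
  have p1 : col (S.opPQRS (S.P γ) (S.Q K) (S.R1 K) (S.R2 K) w uss).1
      = S.P γ * W + (1 / S.L) • (S.D1ᵀ * c + e) := by
    have hi : Integrable (fun s => act (S.Q K s) (uss s)) S.μ := MInt.integrable (hQ.mul_mInt hV)
    rw [opPQRS, col_add, col_smul, col_act, intervalIntegral.integral_of_le hL.le,
      ← integral_Icc_eq_integral_Ioc, col_integral hi, ← hq]
    rfl
  have p2 : ∀ᵐ s ∂S.μ, col ((S.opPQRS (S.P γ) (S.Q K) (S.R1 K) (S.R2 K) w uss).2 s)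
      = (S.Q K s)ᵀ * W + ((mI S.μ fun θ => S.R K s θ * V θ)
        + (mI S.μ fun θ => (S.R K θ s)ᵀ * V θ) + (S.C3 s)ᵀ * c) := by
    filter_upwards [sec1, sec2, S.ae_mem] with s h1 h2 hs
    have h3 : MInt S.μ fun θ => (S.C3 s)ᵀ * (S.C3 θ * V θ) := iCV.const_mul _
    have ee : (fun θ => S.Rsymm K s θ * V θ) = fun θ =>
        S.R K s θ * V θ + (S.R K θ s)ᵀ * V θ + (S.C3 s)ᵀ * (S.C3 θ * V θ) := by
      funext θ
      simp only [Rsymm, Matrix.add_mul, Matrix.mul_assoc]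
    have h4 : MInt S.μ fun θ => S.Rsymm K s θ * V θ := ee ▸ (h1.add h2).add h3
    have h5 := col_opR hL hK hA0 hA1 hA2 hs h4
    change col (_ + _ + _) = _
    rw [add_assoc, col_add, h5, col_act]
    congr 1
    change (mI S.μ fun θ => S.Rsymm K s θ * V θ) = _
    rw [ee, mI_add (h1.add h2) h3, mI_add h1 h2, mI_const_mul _ iCV]
  have form : ∫ s in (0 : ℝ)..S.L,
      (inner ℝ w (S.opPQRS (S.P γ) (S.Q K) (S.R1 K) (S.R2 K) w uss).1
        + inner ℝ (uss s) ((S.opPQRS (S.P γ) (S.Q K) (S.R1 K) (S.R2 K) w uss).2 s))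
      = (S.L • (Wᵀ * (S.P γ * W + (1 / S.L) • (S.D1ᵀ * c + e)))
        + ((S.D1ᵀ * c + e)ᵀ * W + (J + Jᵀ + cᵀ * c))) () () := by
    set A := Wᵀ * (S.P γ * W + (1 / S.L) • (S.D1ᵀ * c + e)) with hA
    have iA : MInt S.μ fun _ => A := (MBdd.const A).mInt
    have i1 : MInt S.μ fun s => (S.Q K s * V s)ᵀ * W := (hQ.mul_mInt hV).transpose.mul_const W
    have i2 : MInt S.μ fun s => mI S.μ fun θ => (V s)ᵀ * S.R K s θ * V θ := MInt.integral iJ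
    have i3 : MInt S.μ fun s => mI S.μ fun θ => (V s)ᵀ * (S.R K θ s)ᵀ * V θ := MInt.integral iJ'
    have i4 : MInt S.μ fun s => (S.C3 s * V s)ᵀ * c := iCV.transpose.mul_const c
    have e1 : ∫ s in (0 : ℝ)..S.L,
        (inner ℝ w (S.opPQRS (S.P γ) (S.Q K) (S.R1 K) (S.R2 K) w uss).1
          + inner ℝ (uss s) ((S.opPQRS (S.P γ) (S.Q K) (S.R1 K) (S.R2 K) w uss).2 s))
        = (mI S.μ fun s => A + ((S.Q K s * V s)ᵀ * W
          + ((mI S.μ fun θ => (V s)ᵀ * S.R K s θ * V θ)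
            + (mI S.μ fun θ => (V s)ᵀ * (S.R K θ s)ᵀ * V θ) + (S.C3 s * V s)ᵀ * c))) () () := by
      rw [intervalIntegral_eq hL]
      refine integral_congr_ae ?_
      filter_upwards [sec1, sec2, p2] with s h1 h2 h3
      rw [inner_eq_col, inner_eq_col, h3, p1, ← Matrix.add_apply, hA]
      have k1 : (mI S.μ fun θ => (V s)ᵀ * S.R K s θ * V θ)
          = (V s)ᵀ * mI S.μ fun θ => S.R K s θ * V θ := by
        rw [← mI_const_mul _ h1]
        simp only [Matrix.mul_assoc]
      have k2 : (mI S.μ fun θ => (V s)ᵀ * (S.R K θ s)ᵀ * V θ)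
          = (V s)ᵀ * mI S.μ fun θ => (S.R K θ s)ᵀ * V θ := by
        rw [← mI_const_mul _ h2]
        simp only [Matrix.mul_assoc]
      rw [k1, k2]
      simp only [Matrix.mul_add, Matrix.transpose_mul, Matrix.mul_assoc, V]
      rfl
    -- Renaming the variables by Fubini turns the transposed kernel into the transpose of `J`; since
    -- `J` is 1 × 1, this supplies the factor 2 of the storage derivative.
    have e2 : (mI S.μ fun s => mI S.μ fun θ => (V s)ᵀ * (S.R K θ s)ᵀ * V θ) = Jᵀ := by
      rw [mI_swap iJ', hJ, ← mI_transpose]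
      congr 1
      funext θ
      rw [← mI_transpose]
      simp only [Matrix.transpose_mul, Matrix.transpose_transpose, Matrix.mul_assoc]
    have e3 : (mI S.μ fun _ => A) = S.L • A := by
      have := mI_smul_const (ν := S.μ) (fun _ => (1 : ℝ)) A
      simpa [hL.le] using this
    rw [e1, mI_add iA (i1.add ((i2.add i3).add i4)), mI_add i1 ((i2.add i3).add i4),
      mI_add (i2.add i3) i4, mI_add i2 i3, e2, e3, mI_mul_const (hQ.mul_mInt hV).transpose,
      mI_mul_const iCV.transpose, mI_transpose, mI_transpose, hq]
  rw [form, stor, out, win]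
  -- The first component is constant in s, so its integral has a factor L, which cancels the 1/L in
  -- `P` and in the operator.
  have hP : S.L • (Wᵀ * (S.P γ * W + (1 / S.L) • (S.D1ᵀ * c + e)))
      = Wᵀ * (S.D1ᵀ * (S.D1 * W)) - γ ^ 2 • (Wᵀ * W) + (Wᵀ * (S.D1ᵀ * c) + Wᵀ * e) := by
    have h1 : S.L * S.L⁻¹ = 1 := mul_inv_cancel₀ hL.ne'
    have h2 : S.L * (γ ^ 2 / S.L) = γ ^ 2 := by field_simp
    simp only [P, Matrix.sub_mul, Matrix.mul_add, Matrix.mul_sub, Matrix.smul_mul,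
      Matrix.mul_smul, smul_add, smul_sub, smul_smul, one_div, h1, h2, one_smul, Matrix.one_mul,
      Matrix.mul_assoc]
  have hs : (Wᵀ * e) () () = (eᵀ * W) () () := by
    have : (Wᵀ * e)ᵀ = eᵀ * W := by rw [Matrix.transpose_mul, Matrix.transpose_transpose]
    rw [← this, Matrix.transpose_apply]
  rw [hP]
  simp only [Matrix.transpose_add, Matrix.add_mul, Matrix.mul_add, Matrix.transpose_mul,
    Matrix.transpose_transpose, Matrix.add_apply, Matrix.sub_apply, Matrix.smul_apply,
    smul_eq_mul, Matrix.transpose_apply, hs, Matrix.mul_assoc]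
  ring

end System
end PDEGain

/-! ### 𝒫 as a bounded symmetric operator, and the dissipation inequality -/

namespace PDEGain

theorem col_injective {n : ℕ} : Function.Injective (col (n := n)) := fun v w h => by
  ext i
  exact congrFun (congrFun h i) ()

namespace System

variable {n m q : ℕ} {S : System n m q} {K : Kernel n}

theorem mInt_Lp {f : ℝ → E n} (hf : MemLp f 2 S.μ) : MInt S.μ fun t => col (f t) :=
  mInt_col (hf.integrable one_le_two)

theorem opP_congr (hK : K.Cont) {f g : ℝ → E n} (hf : MemLp f 2 S.μ) (h : f =ᵐ[S.μ] g) :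
    S.opP K f =ᵐ[S.μ] S.opP K g := by
  have hK' : S.RegularKernel K := hK.regular
  have hg : MemLp g 2 S.μ := hf.ae_eq h
  filter_upwards [S.ae_mem, h] with s hs h'
  apply col_injective
  rw [col_opP hK' (mInt_Lp hf) hs, col_opP hK' (mInt_Lp hg) hs, Y_eq hK' (mInt_Lp hf) hs,
    Y_eq hK' (mInt_Lp hg) hs, h']
  congr 1
  exact mI_congr (h.mono fun θ hθ => by simp only [hθ])

theorem opP_add (hK : K.Cont) {f g : ℝ → E n} (hf : MemLp f 2 S.μ) (hg : MemLp g 2 S.μ) :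
    S.opP K (f + g) =ᵐ[S.μ] S.opP K f + S.opP K g := by
  have hK' : S.RegularKernel K := hK.regular
  filter_upwards [S.ae_mem] with s hs
  apply col_injective
  have hN := hK'.N_right hs
  rw [Pi.add_apply, col_add, col_opP hK' (mInt_Lp (hf.add hg)) hs, col_opP hK' (mInt_Lp hf) hs,
    col_opP hK' (mInt_Lp hg) hs, Y_eq hK' (mInt_Lp (hf.add hg)) hs, Y_eq hK' (mInt_Lp hf) hs,
    Y_eq hK' (mInt_Lp hg) hs]
  simp only [Pi.add_apply, col_add, Matrix.mul_add]
  rw [mI_add (hN.mul_mInt (mInt_Lp hf)) (hN.mul_mInt (mInt_Lp hg))]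
  abel

theorem opP_smul (hK : K.Cont) (c : ℝ) {f : ℝ → E n} (hf : MemLp f 2 S.μ) :
    S.opP K (c • f) =ᵐ[S.μ] c • S.opP K f := by
  have hK' : S.RegularKernel K := hK.regular
  filter_upwards [S.ae_mem] with s hs
  apply col_injective
  rw [Pi.smul_apply, col_smul, col_opP hK' (mInt_Lp (hf.const_smul c)) hs,
    col_opP hK' (mInt_Lp hf) hs, Y_eq hK' (mInt_Lp (hf.const_smul c)) hs, Y_eq hK' (mInt_Lp hf) hs]
  simp only [Pi.smul_apply, col_smul, Matrix.mul_smul, mI_smul, smul_add]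

/-- A bounded kernel maps L₁ to bounded functions. On [0, L] this puts the integral part of 𝒫 in L₂.
-/
theorem mBdd_mI_N (hK : K.Cont) {f : ℝ → E n} (hf : MInt S.μ fun t => col (f t)) :
    MBdd S.μ fun s => mI S.μ fun θ => K.N s θ * col (f θ) := fun i j => by
  have hN := tame_N (S := S) hK
  have hi : MInt (S.μ.prod S.μ) fun p => K.N p.1 p.2 * col (f p.2) :=
    (hN.mBdd S.ae_mem_prod).mul_mInt hf.snd
  choose hm C hC using hN
  refine memLp_top_of_bound (MInt.integral hi i j).1 (∫ θ, ∑ k, C i k * |f θ k| ∂S.μ)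
    (S.ae_mem.mono fun s hs => ?_)
  refine norm_integral_le_of_norm_le (integrable_finsetSum _ fun k _ =>
    ((hf k ()).abs.const_mul _)) (S.ae_mem.mono fun θ hθ => ?_)
  change |(K.N s θ * col (f θ)) i j| ≤ _
  rw [Matrix.mul_apply]
  refine (Finset.abs_sum_le_sum_abs _ _).trans (Finset.sum_le_sum fun k _ => ?_)
  rw [abs_mul]
  exact mul_le_mul_of_nonneg_right (hC i k (s, θ) ⟨hs, hθ⟩) (abs_nonneg _)

theorem memLp_opP (hK : K.Cont) {f : ℝ → E n} (hf : MemLp f 2 S.μ) :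
    MemLp (S.opP K f) 2 S.μ := by
  have hK' : S.RegularKernel K := hK.regular
  refine MemLp.of_eval_piLp fun i => ?_
  have h1 : MemLp (fun s => (K.M s * col (f s)) i ()) 2 S.μ := by
    simp only [Matrix.mul_apply]
    refine memLp_finsetSum _ fun k _ => ?_
    exact (hf.eval_piLp k).mul (hK'.M i k)
  have h2 : MemLp (fun s => (mI S.μ fun θ => K.N s θ * col (f θ)) i ()) 2 S.μ :=
    (mBdd_mI_N hK (mInt_Lp hf) i ()).mono_exponent le_top
  refine (h1.add h2).ae_eq (S.ae_mem.mono fun s hs => ?_)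
  have h3 := congrFun (congrFun ((col_opP hK' (mInt_Lp hf) hs).trans
    (Y_eq hK' (mInt_Lp hf) hs)) i) ()
  exact h3.symm

/-- The operator `𝒫` as a linear map of `L₂`. -/
def opLin (hK : K.Cont) : S.Z →ₗ[ℝ] S.Z where
  toFun f := (memLp_opP hK (Lp.memLp f)).toLp _
  map_add' f g := by
    refine Lp.ext ?_
    filter_upwards [(memLp_opP hK (Lp.memLp (f + g))).coeFn_toLp,
      (memLp_opP hK (Lp.memLp f)).coeFn_toLp, (memLp_opP hK (Lp.memLp g)).coeFn_toLp,
      Lp.coeFn_add ((memLp_opP hK (Lp.memLp f)).toLp _) ((memLp_opP hK (Lp.memLp g)).toLp _),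
      opP_congr hK (Lp.memLp (f + g)) (Lp.coeFn_add f g), opP_add hK (Lp.memLp f) (Lp.memLp g)]
      with s h1 h2 h3 h4 h5 h6
    rw [h1, h4, h5, h6, Pi.add_apply, Pi.add_apply, h2, h3]
  map_smul' c f := by
    refine Lp.ext ?_
    filter_upwards [(memLp_opP hK (Lp.memLp (c • f))).coeFn_toLp,
      (memLp_opP hK (Lp.memLp f)).coeFn_toLp,
      Lp.coeFn_smul c ((memLp_opP hK (Lp.memLp f)).toLp _),
      opP_congr hK (Lp.memLp (c • f)) (Lp.coeFn_smul c f), opP_smul hK c (Lp.memLp f)]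
      with s h1 h2 h4 h5 h6
    rw [h1, RingHom.id_apply, h4, h5, h6, Pi.smul_apply, Pi.smul_apply, h2]

theorem inner_opLin (hL : 0 < S.L) (hK : K.Cont) (f g : S.Z) :
    inner ℝ f (opLin hK g) = ∫ s in (0 : ℝ)..S.L, inner ℝ (f s) (S.opP K g s) := by
  rw [intervalIntegral_eq hL, L2.inner_def]
  exact integral_congr_ae ((memLp_opP hK (Lp.memLp g)).coeFn_toLp.mono fun s hs => by
    simp only [opLin, LinearMap.coe_mk, AddHom.coe_mk, hs])

theorem isSymmetric_opLin (hL : 0 < S.L) (hK : K.Cont) (h : S.SelfAdjoint K) :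
    (opLin (S := S) hK).IsSymmetric := fun f g => by
  rw [inner_opLin hL hK, h _ _ (Lp.memLp f) (Lp.memLp g), real_inner_comm, inner_opLin hL hK]
  simp only [real_inner_comm]

/-- The operator `𝒫` as a bounded operator of `L₂`. -/
def opCLM (hL : 0 < S.L) (hK : K.Cont) (h : S.SelfAdjoint K) : S.Z →L[ℝ] S.Z :=
  -- Hellinger–Toeplitz: an everywhere defined symmetric operator on a Hilbert space is bounded.
  ⟨opLin hK, (isSymmetric_opLin hL hK h).continuous⟩

/-- The dissipation inequality along a solution. -/
theorem dissipation (hL : 0 < S.L) (hB : IsUnit S.B2.det) (hK : K.Cont) (hA0 : MBdd S.μ S.A0)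
    (hA1 : MBdd S.μ S.A1) (hA2 : MBdd S.μ S.A2) (hB1 : MBdd S.μ S.B1) (hCa : MBdd S.μ S.Ca)
    (hCb : MBdd S.μ S.Cb) {γ : ℝ} (hsa : S.SelfAdjoint K)
    (hP : S.PQRSNonpos (S.P γ) (S.Q K) (S.R1 K) (S.R2 K)) {u us uss : ℝ → E n}
    (h : S.IsState u us uss) {f g : S.Z} {w : E m} (hf : f =ᵐ[S.μ] u)
    (hg : g =ᵐ[S.μ] S.rhs u us uss w) :
    2 * inner ℝ g (opCLM hL hK hsa f) + ‖S.output u us w‖ ^ 2 ≤ γ ^ 2 * ‖w‖ ^ 2 := by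
  have h1 := hP w uss h.memLp
  rw [h.energy hL hB hK hA0 hA1 hA2 hB1 hCa hCb w γ] at h1
  have h2 : inner ℝ g (opCLM hL hK hsa f)
      = ∫ s in (0 : ℝ)..S.L, inner ℝ (u s) (S.opP K (S.rhs u us uss w) s) := by
    -- Symmetry moves 𝒫 from the state to its time derivative, the form in which the energy identity
    -- is stated.
    have e : inner ℝ g (opCLM hL hK hsa f) = inner ℝ f (opLin hK g) := by
      rw [← isSymmetric_opLin hL hK hsa, real_inner_comm]
      rfl
    rw [e, inner_opLin hL hK, intervalIntegral_eq hL, intervalIntegral_eq hL]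
    refine integral_congr_ae ?_
    filter_upwards [hf, opP_congr hK (Lp.memLp g) hg] with s h3 h4
    rw [h3, h4]
  rw [h2]
  linarith

end System

/-! ### The chain rule for the storage function in time -/

section Time

variable {H : Type*} [NormedAddCommGroup H] [InnerProductSpace ℝ H] [CompleteSpace H]

/-- The chain rule for the quadratic form of a symmetric operator along an absolutely continuous
curve, in integrated form. -/
theorem inner_integral_eq_two_mul (P : H →L[ℝ] H) (hP : (P : H →ₗ[ℝ] H).IsSymmetric) {f : ℝ → H}
    {t : ℝ} (ht : 0 ≤ t) (hf : IntervalIntegrable f volume 0 t) :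
    IntegrableOn (fun τ => inner ℝ (f τ) (P (∫ σ in (0 : ℝ)..τ, f σ))) (Ioc 0 t) ∧
    inner ℝ (∫ τ in (0 : ℝ)..t, f τ) (P (∫ τ in (0 : ℝ)..t, f τ))
      = 2 * ∫ τ in Ioc 0 t, inner ℝ (f τ) (P (∫ σ in (0 : ℝ)..τ, f σ)) := by
  set ν : Measure ℝ := volume.restrict (Ioc 0 t) with hν
  have hi : Integrable f ν := (intervalIntegrable_iff_integrableOn_Ioc_of_le ht).1 hf
  have hF : Integrable (fun p : ℝ × ℝ => inner ℝ (f p.1) (P (f p.2))) (ν.prod ν) := by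
    refine Integrable.op_fst_snd (op := fun a b : H => inner ℝ a (P b)) (by fun_prop)
      ⟨‖P‖, fun x y => ?_⟩ hi hi
    calc ‖inner ℝ x (P y)‖ ≤ ‖x‖ * ‖P y‖ := norm_inner_le_norm _ _
      _ ≤ ‖x‖ * (‖P‖ * ‖y‖) := by gcongr; exact P.le_opNorm y
      _ = ‖P‖ * ‖x‖ * ‖y‖ := by ring
  have hle : MeasurableSet {p : ℝ × ℝ | p.2 ≤ p.1} := measurableSet_le measurable_snd measurable_fst
  have hlt : MeasurableSet {p : ℝ × ℝ | p.1 < p.2} := measurableSet_lt measurable_fst measurable_snd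
  have hF1 := hF.indicator hle
  have hF2 := hF.indicator hlt
  -- The set is left free up to null sets so that the same computation serves the closed lower
  -- triangle and the open upper one, which partition the square exactly.
  have sec : ∀ v : H, ∀ τ ∈ Ioc 0 t, ∀ A : Set ℝ, (A =ᵐ[volume] Iic τ) → MeasurableSet A →
      ∫ σ, A.indicator (fun σ => inner ℝ v (P (f σ))) σ ∂ν
        = inner ℝ v (P (∫ σ in (0 : ℝ)..τ, f σ)) := by
    intro v τ hτ A hA hAm
    have hiτ : IntegrableOn f (Ioc 0 τ) := by
      have : IntegrableOn f (Ioc 0 t) := hi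
      exact this.mono_set (Ioc_subset_Ioc_right hτ.2)
    rw [setIntegral_indicator hAm, intervalIntegral.integral_of_le hτ.1.le,
      ← P.integral_comp_comm hiτ, ← integral_inner (P.integrable_comp hiτ)]
    refine setIntegral_congr_set ?_
    have : (Ioc 0 τ : Set ℝ) = Ioc 0 t ∩ Iic τ := by
      rw [Ioc_inter_Iic, min_eq_right hτ.2]
    rw [this]
    exact (Filter.EventuallyEq.refl _ _).inter hA
  have mem : ∀ᵐ τ ∂ν, τ ∈ Ioc 0 t := ae_restrict_mem measurableSet_Ioc
  have e1 : ∀ᵐ τ ∂ν, ∫ σ, {p : ℝ × ℝ | p.2 ≤ p.1}.indicator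
      (fun p : ℝ × ℝ => inner ℝ (f p.1) (P (f p.2))) (τ, σ) ∂ν
      = inner ℝ (f τ) (P (∫ σ in (0 : ℝ)..τ, f σ)) :=
    mem.mono fun τ hτ => sec (f τ) τ hτ (Iic τ) (Filter.EventuallyEq.refl _ _) measurableSet_Iic
  have e2 : ∀ᵐ σ ∂ν, ∫ τ, {p : ℝ × ℝ | p.1 < p.2}.indicator
      (fun p : ℝ × ℝ => inner ℝ (f p.1) (P (f p.2))) (τ, σ) ∂ν
      = inner ℝ (f σ) (P (∫ τ in (0 : ℝ)..σ, f τ)) := by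
    refine mem.mono fun σ hσ => ?_
    rw [← sec (f σ) σ hσ (Iio σ) Iio_ae_eq_Iic measurableSet_Iio]
    refine integral_congr_ae (Filter.Eventually.of_forall fun τ => ?_)
    by_cases h : τ < σ
    · simp only [indicator, mem_ofPred_eq, mem_Iio, h, if_true]
      rw [real_inner_comm]
      exact hP _ _
    · simp [indicator, h]
  refine ⟨hF1.integral_prod_left.congr e1, ?_⟩
  -- The quadratic form of the primitive is a double integral over the square; by `e1`, `e2` and the
  -- symmetry of `P`, its two triangles contribute equally.
  have e3 : inner ℝ (∫ τ in (0 : ℝ)..t, f τ) (P (∫ τ in (0 : ℝ)..t, f τ))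
      = ∫ τ, ∫ σ, inner ℝ (f τ) (P (f σ)) ∂ν ∂ν := by
    rw [intervalIntegral.integral_of_le ht, real_inner_comm, ← integral_inner hi]
    refine integral_congr_ae (Filter.Eventually.of_forall fun τ => ?_)
    simp only
    rw [real_inner_comm, ← P.integral_comp_comm hi, ← integral_inner (P.integrable_comp hi)]
  have e4 : (fun p : ℝ × ℝ => inner ℝ (f p.1) (P (f p.2)))
      = fun p => {p : ℝ × ℝ | p.2 ≤ p.1}.indicator
          (fun p : ℝ × ℝ => inner ℝ (f p.1) (P (f p.2))) p
        + {p : ℝ × ℝ | p.1 < p.2}.indicator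
          (fun p : ℝ × ℝ => inner ℝ (f p.1) (P (f p.2))) p := by
    funext p
    by_cases h : p.2 ≤ p.1
    · simp [indicator, h, h.not_gt]
    · simp [indicator, h, not_le.1 h]
  have e5 : ∫ τ, ∫ σ, inner ℝ (f τ) (P (f σ)) ∂ν ∂ν
      = ∫ p, inner ℝ (f p.1) (P (f p.2)) ∂(ν.prod ν) := (integral_prod _ hF).symm
  rw [e3, e5, e4, integral_add hF1 hF2, integral_prod _ hF1, integral_prod_symm _ hF2,
    integral_congr_ae e1, integral_congr_ae e2]
  ring

end Time

theorem eLpNorm_two_sq {α F : Type*} [MeasurableSpace α] [NormedAddCommGroup F] (ν : Measure α)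
    (f : α → F) : eLpNorm f 2 ν ^ 2 = ∫⁻ t, ‖f t‖ₑ ^ 2 ∂ν := by
  have h := eLpNorm_nnreal_pow_eq_lintegral (p := 2) (f := f) (μ := ν) two_ne_zero
  simpa using h

theorem continuous_ofPolynomials {n : ℕ} (M : Matrix (Fin n) (Fin n) (Polynomial ℝ))
    (N1 N2 : Matrix (Fin n) (Fin n) (MvPolynomial (Fin 2) ℝ)) :
    (Kernel.ofPolynomials M N1 N2).Cont where
  M i j := (M i j).continuous
  N1 i j := (MvPolynomial.continuous_eval (N1 i j)).comp
    (by fun_prop : Continuous fun p : ℝ × ℝ => ![p.1, p.2])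
  N2 i j := (MvPolynomial.continuous_eval (N2 i j)).comp
    (by fun_prop : Continuous fun p : ℝ × ℝ => ![p.1, p.2])

end PDEGain

end

/-! ### Integration of the dissipation inequality and the limit T → ∞ -/

open PDEGain in
theorem mainTheorem2 {n m q : ℕ} (S : System n m q)
    (hL : 0 < S.L) (hB : IsUnit S.B2.det)
    (hA0 : EssBounded S.L S.A0) (hA1 : EssBounded S.L S.A1) (hA2 : EssBounded S.L S.A2)
    (hB1 : EssBounded S.L S.B1) (hCa : EssBounded S.L S.Ca) (hCb : EssBounded S.L S.Cb)
    (γ : ℝ) (hγ : 0 ≤ γ)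
    (hP : ∃ (M : Matrix (Fin n) (Fin n) (Polynomial ℝ))
        (N1 N2 : Matrix (Fin n) (Fin n) (MvPolynomial (Fin 2) ℝ)),
      S.SelfAdjoint (Kernel.ofPolynomials M N1 N2) ∧
      S.Coercive (Kernel.ofPolynomials M N1 N2) ∧
      S.PQRSNonpos (S.P γ) (S.Q (Kernel.ofPolynomials M N1 N2))
        (S.R1 (Kernel.ofPolynomials M N1 N2)) (S.R2 (Kernel.ofPolynomials M N1 N2)))
    (w : ℝ → E m) (hw : MemLp w 2 (volume.restrict (Ici (0 : ℝ))))
    (x : ℝ → S.Z) (y : ℝ → E q)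
    (hy : AEStronglyMeasurable y (volume.restrict (Ici (0 : ℝ))))
    (hxy : S.IsSolution w x y) :
    MemLp y 2 (volume.restrict (Ici (0 : ℝ))) ∧
      eLpNorm y 2 (volume.restrict (Ici (0 : ℝ)))
        ≤ ENNReal.ofReal γ * eLpNorm w 2 (volume.restrict (Ici (0 : ℝ))) := by
  obtain ⟨M, N1, N2, hsa, ⟨ε, hε, hco⟩, hneg⟩ := hP
  obtain ⟨xdot, hint, hx, hae⟩ := hxy
  have hK := continuous_ofPolynomials M N1 N2
  set K := Kernel.ofPolynomials M N1 N2
  set P := System.opCLM hL hK hsa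
  have hPs : (P : S.Z →ₗ[ℝ] S.Z).IsSymmetric := System.isSymmetric_opLin hL hK hsa
  have hdis : ∀ᵐ t ∂(volume.restrict (Ici (0 : ℝ))),
      2 * inner ℝ (xdot t) (P (x t)) + ‖y t‖ ^ 2 ≤ γ ^ 2 * ‖w t‖ ^ 2 := by
    filter_upwards [hae] with t ⟨u, us, uss, hs, hu, hd, ho⟩
    rw [ho]
    exact System.dissipation hL hB hK hA0 hA1 hA2 hB1 hCa hCb hsa hneg hs hu hd
  have hw2 : Integrable (fun t => ‖w t‖ ^ 2) (volume.restrict (Ici (0 : ℝ))) :=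
    (memLp_two_iff_integrable_sq_norm hw.1).1 hw
  set c := γ ^ 2 * ∫ t in Ici (0 : ℝ), ‖w t‖ ^ 2 with hc
  -- The lower integral is used because integrability of ‖y‖² is part of the conclusion; the bound
  -- does not depend on T.
  have key : ∀ T : ℝ, 0 ≤ T → ∫⁻ t in Ioc 0 T, ‖y t‖ₑ ^ 2 ≤ ENNReal.ofReal c := by
    intro T hT
    have hsub : Ioc 0 T ⊆ Ici (0 : ℝ) := fun t ht => ht.1.le
    obtain ⟨hi, he⟩ := inner_integral_eq_two_mul P hPs hT (hint T hT)
    have hpos : 0 ≤ inner ℝ (∫ τ in (0 : ℝ)..T, xdot τ) (P (∫ τ in (0 : ℝ)..T, xdot τ)) := by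
      set z : S.Z := ∫ τ in (0 : ℝ)..T, xdot τ
      have h1 : inner ℝ z (P z) = ∫ s in (0 : ℝ)..S.L, inner ℝ (z s) (S.opP K z s) :=
        System.inner_opLin hL hK z z
      rw [h1]
      exact (mul_nonneg hε.le (intervalIntegral.integral_nonneg hL.le fun _ _ => by
        positivity)).trans (hco z (Lp.memLp z))
    have hwT : IntegrableOn (fun t => γ ^ 2 * ‖w t‖ ^ 2) (Ioc 0 T) := by
      have : IntegrableOn (fun t => γ ^ 2 * ‖w t‖ ^ 2) (Ici 0) := hw2.const_mul _
      exact this.mono_set hsub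
    -- An integrable majorant of ‖y‖²: its integral is the supplied energy minus the storage at time
    -- T.
    set g : ℝ → ℝ := fun t => γ ^ 2 * ‖w t‖ ^ 2
      - 2 * inner ℝ (xdot t) (P (∫ σ in (0 : ℝ)..t, xdot σ))
    have hg : IntegrableOn g (Ioc 0 T) := hwT.sub (hi.const_mul 2)
    have hyg : ∀ᵐ t ∂(volume.restrict (Ioc 0 T)), ‖y t‖ ^ 2 ≤ g t := by
      filter_upwards [ae_restrict_of_ae_restrict_of_subset hsub hdis,
        ae_restrict_mem measurableSet_Ioc] with t h1 h2
      rw [hx t h2.1.le] at h1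
      simp only [g]
      linarith
    calc ∫⁻ t in Ioc 0 T, ‖y t‖ₑ ^ 2 ≤ ∫⁻ t in Ioc 0 T, ENNReal.ofReal (g t) := by
          refine lintegral_mono_ae (hyg.mono fun t ht => ?_)
          rw [← ofReal_norm, ← ENNReal.ofReal_pow (norm_nonneg _)]
          exact ENNReal.ofReal_le_ofReal ht
      _ = ENNReal.ofReal (∫ t in Ioc 0 T, g t) :=
          (ofReal_integral_eq_lintegral_ofReal hg
            (hyg.mono fun t ht => (sq_nonneg _).trans ht)).symm
      _ ≤ ENNReal.ofReal c := by
          apply ENNReal.ofReal_le_ofReal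
          rw [integral_sub hwT (hi.const_mul 2), integral_const_mul, integral_const_mul, ← he]
          have h3 : ∫ t in Ioc 0 T, ‖w t‖ ^ 2 ≤ ∫ t in Ici (0 : ℝ), ‖w t‖ ^ 2 :=
            setIntegral_mono_set hw2 (Filter.Eventually.of_forall fun _ => by positivity)
              (Filter.Eventually.of_forall hsub)
          have h4 := mul_le_mul_of_nonneg_left h3 (sq_nonneg γ)
          linarith
  have total : ∫⁻ t in Ici (0 : ℝ), ‖y t‖ₑ ^ 2 ≤ ENNReal.ofReal c := by
    -- Monotone convergence along the intervals (0, k] with k a natural number, whose union omits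
    -- only the null point 0.
    rw [← setLIntegral_congr (Ioi_ae_eq_Ici (a := (0 : ℝ))),
      ← iUnion_Ioc_eq_Ioi_self_iff.2 (fun t _ => exists_nat_ge t),
      setLIntegral_iUnion_of_directed]
    · exact iSup_le fun k => key k k.cast_nonneg
    · exact (Monotone.directed_le fun a b hab =>
        Ioc_subset_Ioc_right (Nat.cast_le.2 hab))
  have hwc : ENNReal.ofReal c
      = (ENNReal.ofReal γ * eLpNorm w 2 (volume.restrict (Ici (0 : ℝ)))) ^ 2 := by
    rw [mul_pow, eLpNorm_two_sq, hc, ENNReal.ofReal_mul (sq_nonneg γ), ENNReal.ofReal_pow hγ,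
      ofReal_integral_eq_lintegral_ofReal hw2 (Filter.Eventually.of_forall fun _ => by positivity)]
    congr 2
    funext t
    rw [← ofReal_norm, ENNReal.ofReal_pow (norm_nonneg _)]
  have hfin : eLpNorm y 2 (volume.restrict (Ici (0 : ℝ)))
      ≤ ENNReal.ofReal γ * eLpNorm w 2 (volume.restrict (Ici (0 : ℝ))) := by
    rw [← ENNReal.pow_le_pow_left_iff two_ne_zero, eLpNorm_two_sq, ← hwc]
    exact total
  exact ⟨⟨hy, hfin.trans_lt (ENNReal.mul_lt_top ENNReal.ofReal_lt_top hw.2)⟩, hfin⟩
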